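/- **Setting.** Let $n\ge 1$, $d\ge 0$, let $f(\cdot;x_1),\dots,f(\cdot;x_n):\mathbb{R}^d\to\mathbb{R}$ be differentiable losses, let $f(w)=\frac1n\sum_{j=1}^n f(w;x_j)$ be bounded below, and $f^*=\inf_v f(v)$. Write $\|\cdot\|$ for the $\ell_2$ norm. Let $A,\varsigma,L,L_{2,\infty},L_\infty>0$ and assume, for all $w,v\in\mathbb{R}^d$ and all $j$: * (Smoothness) $\|\nabla f(w;x_j)-\nabla f(v;x_j)\|_2\le L_{2,\infty}\|w-v\|_\infty$, $\ \|\nabla f(w;x_j)-\nabla f(v;x_j)\|_\infty\le L_\infty\|w-v\|_\infty$, $\ \|\nabla f(w)-\nabla f(v)\|_2\le L\|w-v\|_2$. * (Bounded gradient error) $\|\nabla f(w;x_j)-\frac1n\sum_{s=1}^n\nabla f(w;x_s)\|_2\le\varsigma$. * (Balancing bound) $\texttt{Balancing}$ is an online sign rule: in each step it receives the current signed sum $s$ and the current vector $z$ and returns a sign in $\{-1,+1\}$ (it may differ from step to step and from epoch to epoch, e.g. through realised internal randomness). In every epoch, for every $c>0$ and all vectors $z_1,\dots,z_n\in\mathbb{R}^d$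 with $\|z_i\|_2\le c$, the signs $\epsilon_i$ that it returns when it is fed $z_1,\dots,z_n$ in this order, starting from $s=0$, satisfy $\|\sum_{i=1}^k\epsilon_i z_i\|_\infty\le A\,c$ for all $k\in\{1,\dots,n\}$. **Algorithm (GraB).** Given a step size $\alpha\ge0$, a weight $w_1\in\mathbb{R}^d$, a permutation $\sigma_1$ of $\{1,\dots,n\}$ and the stale mean $m_1=0$, epoch $k=1,2,\dots$ starts from $w_k^{(1)}=w_k$, $s=0$, and for $t=1,\dots,n$ puts $g_{k,t}=\nabla f(w_k^{(t)};x_{\sigma_k(t)})-m_k$, $\epsilon_{k,t}=\texttt{Balancing}(s,g_{k,t})$, $s\leftarrow s+\epsilon_{k,t}g_{k,t}$, and $w_k^{(t+1)}=w_k^{(t)}-\alpha\nabla f(w_k^{(t)};x_{\sigma_k(t)})$. At the end of the epoch $w_{k+1}=w_k^{(n+1)}$, $m_{k+1}=\frac1n\sum_{t=1}^n\nabla f(w_k^{(t)};x_{\sigma_k(t)})$, and $\sigma_{k+1}$ lists first the examples $\sigma_k(t)$ with $\epsilon_{k,t}=+1$ in the order of $t$, then those with $\epsilon_{k,t}=-1$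 in the reversed order of $t$. Let $F=f(w_1)-f^*$. **Theorem 3.** (i) For every $K\ge1$, if $$\alpha=\min\left\{\sqrt[3]{\frac{F}{32nA^2\varsigma^2L_{2,\infty}^2K}},\ \frac1{nL},\ \frac1{26(n+A)L_{2,\infty}},\ \frac1{260nL_\infty}\right\},$$ then $$\frac1K\sum_{k=1}^K\|\nabla f(w_k)\|^2\le 11\sqrt[3]{\frac{A^2\varsigma^2L_{2,\infty}^2F^2}{n^2K^2}}+\frac{\varsigma^2}{K}+\frac{1040\,F(L+L_{2,\infty}+L_\infty)}{K}+\frac{104\,FAL_{2,\infty}}{nK}.$$ (ii) Suppose in addition that the Polyak–Łojasiewicz condition $\frac12\|\nabla f(w)\|^2\ge\mu(f(w)-f^*)$ holds for all $w$, with some $\mu>0$. Put $X=\dfrac{(F+\varsigma^2)n^2\mu^3K^2}{256A^2L_{2,\infty}^2\varsigma^2}$ and $$\alpha=\min\left\{\frac1{n\mu},\ \frac1{nL},\ \frac1{52(n+A)L_{2,\infty}},\ \frac1{520nL_\infty},\ \frac{2}{n\mu K}W_0(X)\right\},$$ where $W_0$ is the principal branch of the Lambert W function. Then $f(w_K)-f^*\le\tilde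 O\!\left(\dfrac{A^2L_{2,\infty}^2\varsigma^2}{\mu^3n^2K^2}\right)$ as $K\to\infty$, in the following sense: there is an absolute constant $C>0$ such that, for all $K\ge K_0$, where $K_0$ depends only on $n,A,\varsigma,L,L_{2,\infty},L_\infty,\mu,F$, $$f(w_K)-f^*\le C\,\frac{A^2L_{2,\infty}^2\varsigma^2}{\mu^3n^2K^2}\,\bigl(1+\log(1+X)\bigr)^2 .$$ -/

import Mathlib

noncomputable section

namespace GraB

/-- The parameter space `ℝ^d`; its norm `‖·‖` is the Euclidean (`ℓ₂`) norm. -/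
abbrev Vec (d : ℕ) : Type := EuclideanSpace ℝ (Fin d)

/-- The `ℓ_∞` norm on `ℝ^d` (the norm of the function space `Fin d → ℝ` is the sup norm). -/
def supNorm {d : ℕ} (x : Vec d) : ℝ := ‖WithLp.ofLp x‖

/-! ### The objective and the assumptions on it -/

/-- The objective `f(w) = (1/n) ∑_j f(w; x_j)`; the loss of example `j` is `f j`. -/
def avgLoss {n d : ℕ} (f : Fin n → Vec d → ℝ) (w : Vec d) : ℝ :=
  (1 / (n : ℝ)) * ∑ j, f j w

/-- `f^* = inf_v f(v)`; used only for objectives that are bounded below. -/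
def fStar {n d : ℕ} (f : Fin n → Vec d → ℝ) : ℝ := ⨅ v, avgLoss f v

/-- Smoothness: every loss is differentiable, its gradient is `L2inf`-Lipschitz from `ℓ_∞` to `ℓ₂`
and `Linf`-Lipschitz from `ℓ_∞` to `ℓ_∞`; the gradient of the averaged loss is `L`-Lipschitz
from `ℓ₂` to `ℓ₂`. -/
structure Smooth {n d : ℕ} (f : Fin n → Vec d → ℝ) (L L2inf Linf : ℝ) : Prop where
  differentiable : ∀ j, Differentiable ℝ (f j)
  lipschitz_two_sup : ∀ j w v,
    ‖gradient (f j) w - gradient (f j) v‖ ≤ L2inf * supNorm (w - v)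
  lipschitz_sup_sup : ∀ j w v,
    supNorm (gradient (f j) w - gradient (f j) v) ≤ Linf * supNorm (w - v)
  lipschitz_avg : ∀ w v,
    ‖gradient (avgLoss f) w - gradient (avgLoss f) v‖ ≤ L * ‖w - v‖

/-- Bounded gradient error. -/
def BoundedGradientError {n d : ℕ} (f : Fin n → Vec d → ℝ) (ς : ℝ) : Prop :=
  ∀ j w, ‖gradient (f j) w - (1 / (n : ℝ)) • ∑ s, gradient (f s) w‖ ≤ ς

/-- The Polyak–Łojasiewicz inequality with constant `μ`. -/
def PolyakLojasiewicz {n d : ℕ} (f : Fin n → Vec d → ℝ) (μ : ℝ) : Prop :=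
  ∀ w, μ * (avgLoss f w - fStar f) ≤ (1 / 2) * ‖gradient (avgLoss f) w‖ ^ 2

/-! ### Online balancing -/

/-- An online sign rule for one epoch: in step `t` (counted from `0`) it receives the running
signed sum `s` and the current vector `v` and answers with a sign. The dependence on `t` leaves
room for (realised) internal randomness; the rule may ignore it. -/
abbrev SignRule (d : ℕ) : Type := ℕ → Vec d → Vec d → ℤˣ

/-- `∑_{i < t} ε_i z_i`, where `ε_i` is the answer of the rule to the running sum and `z_i`. -/
def signedSum {d : ℕ} (bal : SignRule d) (z : ℕ → Vec d) : ℕ → Vec d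
  | 0 => 0
  | t + 1 =>
      signedSum bal z t + (((bal t (signedSum bal z t) (z t) : ℤˣ) : ℤ) : ℝ) • z t

/-- Balancing bound: on `n` vectors of `ℓ₂` norm at most `c`, all signed prefix sums have `ℓ_∞`
norm at most `A * c`. For `c = 1` these are vectors in the unit ball; the factor `c` says that the
normalisation of the vectors is immaterial to the rule. -/
def BalancingBound {d : ℕ} (n : ℕ) (A : ℝ) (bal : SignRule d) : Prop :=
  ∀ c : ℝ, 0 < c → ∀ z : ℕ → Vec d, (∀ i < n, ‖z i‖ ≤ c) →
    ∀ k ≤ n, supNorm (signedSum bal z k) ≤ A * c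

/-! ### The algorithm -/

/-- The variables inside an epoch: the number of steps done, the weight, the running average of
the gradients (the next stale mean), the signed sum, and the two filled ends of the next order:
`left` holds its positions `1, …, l - 1`, and `right` its positions `r + 1, …, n`. -/
structure EpochState (n d : ℕ) where
  t : ℕ
  w : Vec d
  mNext : Vec d
  s : Vec d
  left : List (Fin n)
  right : List (Fin n)

/-- One inner step, on example `j`, with step size `α` and stale mean `m`. -/
def epochStep {n d : ℕ} (f : Fin n → Vec d → ℝ) (α : ℝ) (bal : SignRule d) (m : Vec d)
    (st : EpochState n d) (j : Fin n) : EpochState n d :=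
  let grad : Vec d := gradient (f j) st.w
  let g : Vec d := grad - m
  let ε : ℤˣ := bal st.t st.s g
  { t := st.t + 1
    w := st.w - α • grad
    mNext := st.mNext + (1 / (n : ℝ)) • grad
    s := if ε = 1 then st.s + g else st.s - g
    left := if ε = 1 then st.left ++ [j] else st.left
    right := if ε = 1 then st.right else j :: st.right }

/-- The variables that are passed from one epoch to the next: the weight, the stale mean and the
order in which the examples will be visited. -/
structure RunState (n d : ℕ) where
  w : Vec d
  m : Vec d
  order : List (Fin n)

/-- One epoch. -/
def runEpoch {n d : ℕ} (f : Fin n → Vec d → ℝ) (α : ℝ) (bal : SignRule d)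
    (r : RunState n d) : RunState n d :=
  let e : EpochState n d :=
    r.order.foldl (epochStep f α bal r.m)
      { t := 0, w := r.w, mNext := 0, s := 0, left := [], right := [] }
  { w := e.w, m := e.mNext, order := e.left ++ e.right }

/-- The state after `k` epochs, started from the weight `w₁`, the order `σ₁` and the stale mean
`0`; `bal k` is the sign rule of epoch `k`, and epochs are counted from `1`. -/
def run {n d : ℕ} (f : Fin n → Vec d → ℝ) (α : ℝ) (bal : ℕ → SignRule d)
    (w₁ : Vec d) (σ₁ : Equiv.Perm (Fin n)) : ℕ → RunState n d
  | 0 => { w := w₁, m := 0, order := List.ofFn σ₁ }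
  | k + 1 => runEpoch f α (bal (k + 1)) (run f α bal w₁ σ₁ k)

/-- The weight `w_k` at the beginning of epoch `k`, for `k ≥ 1`; `weight … 1` is `w₁`. -/
def weight {n d : ℕ} (f : Fin n → Vec d → ℝ) (α : ℝ) (bal : ℕ → SignRule d)
    (w₁ : Vec d) (σ₁ : Equiv.Perm (Fin n)) (k : ℕ) : Vec d :=
  (run f α bal w₁ σ₁ (k - 1)).w

/-! ### The step sizes -/

/-- The principal branch `W₀` of the Lambert W function: the inverse of `y ↦ y * exp y` on
`[-1, ∞)`. -/
def lambertW0 (x : ℝ) : ℝ :=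
  Function.invFunOn (fun y : ℝ => y * Real.exp y) (Set.Ici (-1)) x

/-- The step size of the non-convex case. -/
def stepNonconvex (n K : ℕ) (A ς L L2inf Linf F : ℝ) : ℝ :=
  min ((F / (32 * n * A ^ 2 * ς ^ 2 * L2inf ^ 2 * K)) ^ ((1 : ℝ) / 3))
    (min (1 / (n * L)) (min (1 / (26 * (n + A) * L2inf)) (1 / (260 * n * Linf))))

/-- The argument of `W₀` in the step size of the PL case. -/
def lambertArg (n K : ℕ) (A ς L2inf μ F : ℝ) : ℝ :=
  (F + ς ^ 2) * n ^ 2 * μ ^ 3 * K ^ 2 / (256 * A ^ 2 * L2inf ^ 2 * ς ^ 2)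

/-- The step size of the PL case. -/
def stepPL (n K : ℕ) (A ς L L2inf Linf μ F : ℝ) : ℝ :=
  min (1 / (n * μ)) (min (1 / (n * L)) (min (1 / (52 * (n + A) * L2inf))
    (min (1 / (520 * n * Linf))
      (2 / (n * μ * K) * lambertW0 (lambertArg n K A ς L2inf μ F)))))

end GraB

end

namespace GraB

/-! ### The sup norm -/

/-! An epoch acts as one gradient step of length `α * n` along the mean of the gradients it uses. If
the weights drift by at most `D` in the sup norm during the epoch, that mean differs from the true
gradient by at most `L2inf * D`, and `D` is of order `α * (H + n * ‖∇f(w)‖)`, where `H` bounds the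
prefix sums of the centred gradients in the visiting order. Everything therefore rests on keeping
`H` small.

Reordering does this. Listing the plus examples forwards and the minus examples backwards makes each
new prefix sum, up to sign, half of an old prefix sum plus or minus the corresponding signed sum;
the centred gradients sum to zero, so a prefix may be traded for its complementary suffix
(`supNorm_prefix_reorder_le`). The signed sums obey the balancing bound, so `H` becomes at most `H /
2 + A * ς / 2`, up to errors from the drift and from the stale mean (`supNorm_prefix_next_le`,
`EpochBound.runEpoch`).

Since `H` contracts, its square and that of the stale-mean bound `E` can be added to the
suboptimality as a penalty: `potential_step` shows that this potential falls by a multiple of `α * n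
* ‖∇f(w)‖ ^ 2`, up to noise of order `α * n * (L2inf * α * A * ς) ^ 2`. Summing over epochs gives
the non-convex rate; under the Polyak–Łojasiewicz inequality the potential contracts by `1 - α * n *
μ / 2`. The cube root and the Lambert W step sizes balance the initial term against the noise. -/

theorem supNorm_zero {d : ℕ} : supNorm (0 : Vec d) = 0 := by simp [supNorm]

theorem supNorm_nonneg {d : ℕ} (x : Vec d) : 0 ≤ supNorm x := norm_nonneg _

theorem supNorm_add_le {d : ℕ} (x y : Vec d) : supNorm (x + y) ≤ supNorm x + supNorm y := by
  simpa [supNorm] using norm_add_le (WithLp.ofLp x) (WithLp.ofLp y)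

theorem supNorm_neg {d : ℕ} (x : Vec d) : supNorm (-x) = supNorm x := by simp [supNorm]

theorem supNorm_sub_le {d : ℕ} (x y : Vec d) : supNorm (x - y) ≤ supNorm x + supNorm y := by
  simpa [supNorm] using norm_sub_le (WithLp.ofLp x) (WithLp.ofLp y)

theorem supNorm_sub_comm {d : ℕ} (x y : Vec d) : supNorm (x - y) = supNorm (y - x) := by
  rw [← supNorm_neg, neg_sub]

theorem supNorm_smul {d : ℕ} (a : ℝ) (x : Vec d) : supNorm (a • x) = |a| * supNorm x := by
  simp [supNorm, norm_smul]

theorem supNorm_le_norm {d : ℕ} (x : Vec d) : supNorm x ≤ ‖x‖ := by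
  rw [supNorm, pi_norm_le_iff_of_nonneg (norm_nonneg _)]
  exact fun i => PiLp.norm_apply_le x i

theorem supNorm_sum_le {d : ℕ} {ι : Type*} (s : Finset ι) (x : ι → Vec d) :
    supNorm (∑ i ∈ s, x i) ≤ ∑ i ∈ s, supNorm (x i) := by
  simpa [supNorm] using norm_sum_le s fun i => WithLp.ofLp (x i)

theorem supNorm_sum_range_le {d t n : ℕ} (ht : t ≤ n) (x : ℕ → Vec d) {c : ℝ} (hc : 0 ≤ c)
    (h : ∀ i < t, supNorm (x i) ≤ c) : supNorm (∑ i ∈ Finset.range t, x i) ≤ n * c := by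
  refine (supNorm_sum_le _ _).trans ((Finset.sum_le_card_nsmul _ _ c ?_).trans ?_)
  · exact fun i hi => h i (Finset.mem_range.1 hi)
  · rw [Finset.card_range, nsmul_eq_mul]
    have : (t : ℝ) ≤ n := by exact_mod_cast ht
    gcongr

/-! ### Averages -/

/-- The average of `n` vectors. -/
noncomputable def avg {n d : ℕ} (x : Fin n → Vec d) : Vec d := (1 / (n : ℝ)) • ∑ j, x j

theorem avg_sub {n d : ℕ} (x y : Fin n → Vec d) :
    avg x - avg y = avg fun j => x j - y j := by
  simp [avg, smul_sub]

theorem norm_avg_le {n d : ℕ} (hn : 0 < n) (x : Fin n → Vec d) {c : ℝ}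
    (h : ∀ j, ‖x j‖ ≤ c) : ‖avg x‖ ≤ c := by
  have hn' : (0 : ℝ) < n := by exact_mod_cast hn
  rw [avg, norm_smul, Real.norm_of_nonneg (by positivity), one_div, inv_mul_le_iff₀ hn']
  refine (norm_sum_le _ _).trans ((Finset.sum_le_card_nsmul _ _ c fun j _ => h j).trans ?_)
  simp

theorem supNorm_avg_le {n d : ℕ} (hn : 0 < n) (x : Fin n → Vec d) {c : ℝ}
    (h : ∀ j, supNorm (x j) ≤ c) : supNorm (avg x) ≤ c := by
  have hn' : (0 : ℝ) < n := by exact_mod_cast hn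
  rw [avg, supNorm_smul, abs_of_nonneg (by positivity), one_div, inv_mul_le_iff₀ hn']
  refine (supNorm_sum_le _ _).trans ((Finset.sum_le_card_nsmul _ _ c fun j _ => h j).trans ?_)
  simp

theorem sum_sub_avg {n d : ℕ} (hn : 0 < n) (x : Fin n → Vec d) :
    ∑ j, (x j - avg x) = 0 := by
  have hn' : (n : ℝ) ≠ 0 := by exact_mod_cast hn.ne'
  rw [Finset.sum_sub_distrib, Finset.sum_const, Finset.card_univ, Fintype.card_fin,
    ← Nat.cast_smul_eq_nsmul ℝ, avg, smul_smul]
  simp [hn']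

/-! ### The objective -/

theorem differentiable_avgLoss {n d : ℕ} {f : Fin n → Vec d → ℝ}
    (hf : ∀ j, Differentiable ℝ (f j)) : Differentiable ℝ (avgLoss f) := by
  unfold avgLoss
  fun_prop

theorem gradient_avgLoss {n d : ℕ} {f : Fin n → Vec d → ℝ}
    (hf : ∀ j, Differentiable ℝ (f j)) (w : Vec d) :
    gradient (avgLoss f) w = avg fun j => gradient (f j) w := by
  have h : HasFDerivAt (avgLoss f) ((1 / (n : ℝ)) • ∑ j, fderiv ℝ (f j) w) w := by
    unfold avgLoss
    exact (HasFDerivAt.fun_sum fun j _ => (hf j w).hasFDerivAt).const_mul _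
  rw [gradient, h.fderiv, avg, map_smulₛₗ, map_sum]
  simp [gradient]

/-- The descent lemma. -/
theorem le_add_inner_gradient {d : ℕ} {φ : Vec d → ℝ} {L : ℝ} (hφ : Differentiable ℝ φ)
    (hL : ∀ w v, ‖gradient φ w - gradient φ v‖ ≤ L * ‖w - v‖) (w u : Vec d) :
    φ (w + u) ≤ φ w + inner ℝ (gradient φ w) u + L / 2 * ‖u‖ ^ 2 := by
  let ψ : ℝ → ℝ := fun t => φ (w + t • u) - t * inner ℝ (gradient φ w) u - L / 2 * ‖u‖ ^ 2 * t ^ 2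
  have hψ (t : ℝ) : HasDerivAt ψ (inner ℝ (gradient φ (w + t • u)) u
      - 1 * inner ℝ (gradient φ w) u - L / 2 * ‖u‖ ^ 2 * (2 * t)) t := by
    have h1 : HasDerivAt (fun t : ℝ => w + t • u) u t := by
      simpa using ((hasDerivAt_id t).smul_const u).const_add w
    have h2 := (hφ (w + t • u)).hasGradientAt.hasFDerivAt.comp_hasDerivAt t h1
    have h3 : HasDerivAt (fun t : ℝ => φ (w + t • u)) (inner ℝ (gradient φ (w + t • u)) u) t := by
      simpa [Function.comp_def] using h2
    have h4 : HasDerivAt (fun t : ℝ => t ^ 2) (2 * t) t := by simpa using hasDerivAt_pow 2 t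
    exact (h3.sub ((hasDerivAt_id t).mul_const _)).sub (h4.const_mul _)
  -- Monotonicity of `ψ` on the segment replaces integrating the gradient: the Lipschitz bound makes
  -- its derivative nonpositive.
  have hanti : AntitoneOn ψ (Set.Icc 0 1) := by
    refine antitoneOn_of_deriv_nonpos (convex_Icc 0 1)
      (fun t _ => (hψ t).continuousAt.continuousWithinAt)
      (fun t _ => (hψ t).differentiableAt.differentiableWithinAt) fun t ht => ?_
    rw [interior_Icc] at ht
    rw [(hψ t).deriv]
    have h1 := real_inner_le_norm (gradient φ (w + t • u) - gradient φ w) u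
    rw [inner_sub_left] at h1
    have h2 := hL (w + t • u) w
    rw [add_sub_cancel_left, norm_smul, Real.norm_of_nonneg ht.1.le] at h2
    have h3 := mul_le_mul_of_nonneg_right h2 (norm_nonneg u)
    nlinarith
  have := hanti (Set.left_mem_Icc.2 zero_le_one) (Set.right_mem_Icc.2 zero_le_one) zero_le_one
  simp only [ψ] at this
  simp at this ⊢
  linarith

theorem fStar_le {n d : ℕ} {f : Fin n → Vec d → ℝ}
    (hb : BddBelow (Set.range (avgLoss f))) (w : Vec d) : fStar f ≤ avgLoss f w := ciInf_le hb w

/-- A gradient step of length `1 / L` lowers the objective by at least `‖∇f(w)‖ ^ 2 / (2 * L)`, yet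
cannot go below the infimum. -/
theorem norm_gradient_sq_le {n d : ℕ} {f : Fin n → Vec d → ℝ} {L L2inf Linf : ℝ} (hL : 0 < L)
    (hb : BddBelow (Set.range (avgLoss f))) (hf : Smooth f L L2inf Linf) (w : Vec d) :
    ‖gradient (avgLoss f) w‖ ^ 2 ≤ 2 * L * (avgLoss f w - fStar f) := by
  have h := le_add_inner_gradient (differentiable_avgLoss hf.differentiable) hf.lipschitz_avg w
    (-(1 / L) • gradient (avgLoss f) w)
  have h2 := fStar_le hb (w + -(1 / L) • gradient (avgLoss f) w)
  rw [real_inner_smul_right, real_inner_self_eq_norm_sq, norm_smul, Real.norm_eq_abs, abs_neg,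
    abs_of_pos (by positivity), mul_pow] at h
  have h3 : L / 2 * ((1 / L) ^ 2 * ‖gradient (avgLoss f) w‖ ^ 2)
      = 1 / L * ‖gradient (avgLoss f) w‖ ^ 2 / 2 := by field_simp
  have h4 : 1 / L * ‖gradient (avgLoss f) w‖ ^ 2 ≤ 2 * (avgLoss f w - fStar f) := by linarith
  rw [one_div, inv_mul_le_iff₀ hL] at h4
  linarith

/-- Progress of one step along an approximate gradient `v`. -/
theorem avgLoss_step_le {n d : ℕ} {f : Fin n → Vec d → ℝ} {L L2inf Linf : ℝ}
    (hf : Smooth f L L2inf Linf) (w v : Vec d) {γ c : ℝ} (hγ : 0 ≤ γ) (hγL : γ * L ≤ 1)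
    (hv : ‖gradient (avgLoss f) w - v‖ ≤ c) :
    avgLoss f (w - γ • v) ≤ avgLoss f w - γ / 2 * ‖gradient (avgLoss f) w‖ ^ 2
      + γ / 2 * c ^ 2 := by
  have h := le_add_inner_gradient (differentiable_avgLoss hf.differentiable) hf.lipschitz_avg w
    (-(γ • v))
  have h2 := norm_sub_sq_real (gradient (avgLoss f) w) v
  have h3 : ‖gradient (avgLoss f) w - v‖ ^ 2 ≤ c ^ 2 := by gcongr
  rw [← sub_eq_add_neg, inner_neg_right, real_inner_smul_right, norm_neg, norm_smul,
    Real.norm_of_nonneg hγ, mul_pow] at h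
  -- Once the quadratic term is at most `γ / 2 * ‖v‖ ^ 2`, it combines with the inner product by
  -- polarisation.
  have h4 : L / 2 * (γ ^ 2 * ‖v‖ ^ 2) ≤ γ / 2 * ‖v‖ ^ 2 := by
    have : γ * L * (γ / 2 * ‖v‖ ^ 2) ≤ 1 * (γ / 2 * ‖v‖ ^ 2) := by gcongr
    linarith
  have h5 : γ / 2 * ‖gradient (avgLoss f) w - v‖ ^ 2 ≤ γ / 2 * c ^ 2 := by gcongr
  rw [h2] at h5
  linarith

end GraB

namespace GraB

/-! ### The states inside an epoch -/

/-- The state after `t` steps of an epoch that visits the examples `σ 0, σ 1, …`. -/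
noncomputable def epochAt {n d : ℕ} (f : Fin n → Vec d → ℝ) (α : ℝ) (bal : SignRule d)
    (m w : Vec d) (σ : ℕ → Fin n) : ℕ → EpochState n d
  | 0 => { t := 0, w := w, mNext := 0, s := 0, left := [], right := [] }
  | t + 1 => epochStep f α bal m (epochAt f α bal m w σ t) (σ t)

section Epoch

variable {n d : ℕ} (f : Fin n → Vec d → ℝ) (α : ℝ) (bal : SignRule d) (m w : Vec d)
  (σ : ℕ → Fin n)

/-- The gradient used in step `t`. -/
noncomputable def stepGrad (t : ℕ) : Vec d :=
  gradient (f (σ t)) (epochAt f α bal m w σ t).w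

/-- The sign returned in step `t`. -/
noncomputable def stepSign (t : ℕ) : ℤˣ :=
  bal t (epochAt f α bal m w σ t).s (stepGrad f α bal m w σ t - m)

theorem foldl_epochStep (t : ℕ) :
    ((List.range t).map σ).foldl (epochStep f α bal m)
      { t := 0, w := w, mNext := 0, s := 0, left := [], right := [] }
      = epochAt f α bal m w σ t := by
  induction t with
  | zero => rfl
  | succ t ih => rw [List.range_succ, List.map_append, List.foldl_append, ih]; rfl

theorem epochAt_t (t : ℕ) : (epochAt f α bal m w σ t).t = t := by
  induction t with
  | zero => rfl
  | succ t ih => simp [epochAt, epochStep, ih]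

theorem epochAt_w (t : ℕ) : (epochAt f α bal m w σ t).w
    = w - α • ∑ i ∈ Finset.range t, stepGrad f α bal m w σ i := by
  induction t with
  | zero => simp [epochAt]
  | succ t ih =>
    rw [Finset.sum_range_succ, smul_add, ← sub_sub, ← ih]
    rfl

theorem epochAt_mNext (t : ℕ) : (epochAt f α bal m w σ t).mNext
    = (1 / (n : ℝ)) • ∑ i ∈ Finset.range t, stepGrad f α bal m w σ i := by
  induction t with
  | zero => simp [epochAt]
  | succ t ih =>
    rw [Finset.sum_range_succ, smul_add, ← ih]
    rfl

theorem epochAt_succ_s (t : ℕ) : (epochAt f α bal m w σ (t + 1)).s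
    = (epochAt f α bal m w σ t).s
      + (((stepSign f α bal m w σ t : ℤˣ) : ℤ) : ℝ) • (stepGrad f α bal m w σ t - m) := by
  have h : (epochAt f α bal m w σ (t + 1)).s = if stepSign f α bal m w σ t = 1
      then (epochAt f α bal m w σ t).s + (stepGrad f α bal m w σ t - m)
      else (epochAt f α bal m w σ t).s - (stepGrad f α bal m w σ t - m) := by
    simp [epochAt, epochStep, stepSign, stepGrad, epochAt_t]
    congr
  rw [h]
  rcases Int.units_eq_one_or (stepSign f α bal m w σ t) with h1 | h1 <;> simp [h1]
  abel

theorem epochAt_succ_left (t : ℕ) : (epochAt f α bal m w σ (t + 1)).left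
    = if stepSign f α bal m w σ t = 1 then (epochAt f α bal m w σ t).left ++ [σ t]
      else (epochAt f α bal m w σ t).left := by
  simp [epochAt, epochStep, stepSign, stepGrad, epochAt_t]
  congr

theorem epochAt_succ_right (t : ℕ) : (epochAt f α bal m w σ (t + 1)).right
    = if stepSign f α bal m w σ t = 1 then (epochAt f α bal m w σ t).right
      else σ t :: (epochAt f α bal m w σ t).right := by
  simp [epochAt, epochStep, stepSign, stepGrad, epochAt_t]
  congr

theorem epochAt_s_eq_sum (t : ℕ) : (epochAt f α bal m w σ t).s = ∑ i ∈ Finset.range t,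
    (((stepSign f α bal m w σ i : ℤˣ) : ℤ) : ℝ) • (stepGrad f α bal m w σ i - m) := by
  induction t with
  | zero => simp [epochAt]
  | succ t ih => rw [epochAt_succ_s, ih, Finset.sum_range_succ]

theorem epochAt_s_eq_signedSum (t : ℕ) : (epochAt f α bal m w σ t).s
    = signedSum bal (fun i => stepGrad f α bal m w σ i - m) t := by
  induction t with
  | zero => simp [epochAt, signedSum]
  | succ t ih => rw [epochAt_succ_s, signedSum, ← ih]; rfl

/-! ### The next order -/

theorem left_append_right_perm (t : ℕ) :
    ((epochAt f α bal m w σ t).left ++ (epochAt f α bal m w σ t).right).Perm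
      ((List.range t).map σ) := by
  induction t with
  | zero => simp [epochAt]
  | succ t ih =>
    have h : ((epochAt f α bal m w σ (t + 1)).left ++ (epochAt f α bal m w σ (t + 1)).right).Perm
        (σ t :: ((epochAt f α bal m w σ t).left ++ (epochAt f α bal m w σ t).right)) := by
      rw [epochAt_succ_left, epochAt_succ_right]
      split_ifs
      · rw [List.append_assoc]
        exact List.perm_middle
      · exact List.perm_middle
    rw [List.range_succ, List.map_append]
    exact h.trans ((ih.cons _).trans (List.perm_append_singleton _ _).symm)

/-- Adding the unsigned and the signed sum doubles the terms of sign `+1` and cancels the others;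
subtracting them does the same for the right list. -/
theorem two_smul_sum_left (y : Fin n → Vec d) (t : ℕ) :
    (2 : ℝ) • ((epochAt f α bal m w σ t).left.map y).sum = ∑ i ∈ Finset.range t, y (σ i)
      + ∑ i ∈ Finset.range t, (((stepSign f α bal m w σ i : ℤˣ) : ℤ) : ℝ) • y (σ i) := by
  induction t with
  | zero => simp [epochAt]
  | succ t ih =>
    rw [Finset.sum_range_succ, Finset.sum_range_succ, epochAt_succ_left]
    rcases Int.units_eq_one_or (stepSign f α bal m w σ t) with h1 | h1
    · simp only [h1, if_true, List.map_append, List.sum_append, smul_add, ih]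
      simp [two_smul]
      abel
    · have h2 : (-1 : ℤˣ) ≠ 1 := by decide
      simp only [h1, if_neg h2, ih]
      simp
      abel

theorem two_smul_sum_right (y : Fin n → Vec d) (t : ℕ) :
    (2 : ℝ) • ((epochAt f α bal m w σ t).right.map y).sum = ∑ i ∈ Finset.range t, y (σ i)
      - ∑ i ∈ Finset.range t, (((stepSign f α bal m w σ i : ℤˣ) : ℤ) : ℝ) • y (σ i) := by
  induction t with
  | zero => simp [epochAt]
  | succ t ih =>
    rw [Finset.sum_range_succ, Finset.sum_range_succ, epochAt_succ_right]
    rcases Int.units_eq_one_or (stepSign f α bal m w σ t) with h1 | h1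
    · simp only [h1, if_true, ih]
      simp
    · have h2 : (-1 : ℤˣ) ≠ 1 := by decide
      simp only [h1, if_neg h2, List.map_cons, List.sum_cons, smul_add, ih]
      simp [two_smul]
      abel

/-- The left list grows by one entry at its end, so its prefixes are exactly its earlier states. The
right list grows at its head, which is why suffixes play this role there. -/
theorem exists_eq_left_of_prefix (t : ℕ) (p : List (Fin n))
    (hp : p <+: (epochAt f α bal m w σ t).left) :
    ∃ s ≤ t, p = (epochAt f α bal m w σ s).left := by
  induction t with
  | zero => exact ⟨0, le_rfl, by simpa [epochAt] using hp⟩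
  | succ t ih =>
    by_cases h : p = (epochAt f α bal m w σ (t + 1)).left
    · exact ⟨t + 1, le_rfl, h⟩
    · have : p <+: (epochAt f α bal m w σ t).left := by
        rw [epochAt_succ_left] at h hp
        split_ifs at h hp
        · exact (List.prefix_concat_iff.1 hp).resolve_left (by simpa using h)
        · exact hp
      obtain ⟨s, hs, hps⟩ := ih this
      exact ⟨s, by omega, hps⟩

theorem exists_eq_right_of_suffix (t : ℕ) (p : List (Fin n))
    (hp : p <:+ (epochAt f α bal m w σ t).right) :
    ∃ s ≤ t, p = (epochAt f α bal m w σ s).right := by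
  induction t with
  | zero => exact ⟨0, le_rfl, by simpa [epochAt] using hp⟩
  | succ t ih =>
    by_cases h : p = (epochAt f α bal m w σ (t + 1)).right
    · exact ⟨t + 1, le_rfl, h⟩
    · have : p <:+ (epochAt f α bal m w σ t).right := by
        rw [epochAt_succ_right] at h hp
        split_ifs at h hp
        · exact hp
        · exact (List.suffix_cons_iff.1 hp).resolve_left h
      obtain ⟨s, hs, hps⟩ := ih this
      exact ⟨s, by omega, hps⟩

theorem supNorm_le_of_two_smul_eq {x a b : Vec d} {P Q : ℝ} (ha : supNorm a ≤ P)
    (hb : supNorm b ≤ Q) (h : (2 : ℝ) • x = a + b ∨ (2 : ℝ) • x = a - b) :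
    supNorm x ≤ (P + Q) / 2 := by
  have h2 : 2 * supNorm x = supNorm ((2 : ℝ) • x) := by rw [supNorm_smul]; norm_num
  have h3 : supNorm ((2 : ℝ) • x) ≤ supNorm a + supNorm b := by
    rcases h with h | h <;> rw [h]
    · exact supNorm_add_le _ _
    · exact supNorm_sub_le _ _
  linarith

/-- The prefix sums in the new order are controlled by the unsigned and signed prefix sums in the
old one. -/
theorem supNorm_prefix_reorder_le (y : Fin n → Vec d) {P Q : ℝ}
    (hσ : ((List.range n).map σ).Perm (List.finRange n)) (hy : ∑ j, y j = 0)
    (hP : ∀ t ≤ n, supNorm (∑ i ∈ Finset.range t, y (σ i)) ≤ P)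
    (hQ : ∀ t ≤ n, supNorm (∑ i ∈ Finset.range t,
      (((stepSign f α bal m w σ i : ℤˣ) : ℤ) : ℝ) • y (σ i)) ≤ Q)
    (p : List (Fin n))
    (hp : p <+: (epochAt f α bal m w σ n).left ++ (epochAt f α bal m w σ n).right) :
    supNorm (p.map y).sum ≤ (P + Q) / 2 := by
  rcases List.prefix_or_prefix_of_prefix hp (List.prefix_append _ _) with h | h
  · obtain ⟨s, hs, rfl⟩ := exists_eq_left_of_prefix f α bal m w σ n p h
    exact supNorm_le_of_two_smul_eq (hP s hs) (hQ s hs) (.inl (two_smul_sum_left ..))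
  -- The prefix reaches into the right list. Its complement `q` is an earlier state of that list,
  -- and the total is zero, so both sums have the same sup norm.
  · obtain ⟨r, rfl⟩ := h
    rw [List.prefix_append_right_inj] at hp
    obtain ⟨q, hq⟩ := hp
    obtain ⟨s, hs, rfl⟩ := exists_eq_right_of_suffix f α bal m w σ n q ⟨r, hq⟩
    have htot : (((epochAt f α bal m w σ n).left ++ (epochAt f α bal m w σ n).right).map y).sum
        = 0 := by
      rw [← hy, Fin.sum_univ_def]
      exact (((left_append_right_perm f α bal m w σ n).trans hσ).map y).sum_eq
    rw [← hq, ← List.append_assoc, List.map_append, List.sum_append] at htot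
    rw [eq_neg_of_add_eq_zero_left htot, supNorm_neg]
    exact supNorm_le_of_two_smul_eq (hP s hs) (hQ s hs) (.inr (two_smul_sum_right ..))

/-! ### The drift of the weights -/

/-- The centred gradient of example `j`. -/
noncomputable def centredGrad (v : Vec d) (j : Fin n) : Vec d :=
  gradient (f j) v - avg fun i => gradient (f i) v

variable {f α bal m w σ}

theorem supNorm_epochAt_w_sub_le {L L2inf Linf H D : ℝ} (hα : 0 ≤ α) (hLinf : 0 ≤ Linf)
    (hD0 : 0 ≤ D) (hf : Smooth f L L2inf Linf)
    (hH : ∀ t ≤ n, supNorm (∑ i ∈ Finset.range t, centredGrad f w (σ i)) ≤ H)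
    (hD : α * (n * (Linf * D) + H + n * ‖gradient (avgLoss f) w‖) ≤ D) :
    ∀ t ≤ n, supNorm ((epochAt f α bal m w σ t).w - w) ≤ D := by
  intro t
  induction t using Nat.strong_induction_on with
  | _ t ih =>
    intro ht
    -- The displacement splits into the effect of the earlier drift, a prefix sum of centred
    -- gradients, and copies of the full gradient.
    have h1 : (epochAt f α bal m w σ t).w - w = -(α • (∑ i ∈ Finset.range t,
        (stepGrad f α bal m w σ i - gradient (f (σ i)) w)
        + ∑ i ∈ Finset.range t, centredGrad f w (σ i)
        + ∑ _i ∈ Finset.range t, gradient (avgLoss f) w)) := by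
      rw [epochAt_w, ← Finset.sum_add_distrib, ← Finset.sum_add_distrib, sub_sub_cancel_left]
      simp [centredGrad, gradient_avgLoss hf.differentiable]
    rw [h1, supNorm_neg, supNorm_smul, abs_of_nonneg hα]
    refine le_trans (mul_le_mul_of_nonneg_left ?_ hα) hD
    refine (supNorm_add_le _ _).trans (add_le_add ((supNorm_add_le _ _).trans
      (add_le_add ?_ (hH t ht))) ?_)
    · refine supNorm_sum_range_le ht _ (by positivity) fun i hi => ?_
      refine (hf.lipschitz_sup_sup _ _ _).trans ?_
      exact mul_le_mul_of_nonneg_left (ih i hi (by omega)) hLinf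
    · exact supNorm_sum_range_le ht _ (norm_nonneg _) fun i _ => supNorm_le_norm _

end Epoch

end GraB

namespace GraB

/-! ### Sums along an order, and the estimates for one epoch. -/

theorem norm_sum_range_le {d t n : ℕ} (ht : t ≤ n) (x : ℕ → Vec d) {c : ℝ} (hc : 0 ≤ c)
    (h : ∀ i < t, ‖x i‖ ≤ c) : ‖∑ i ∈ Finset.range t, x i‖ ≤ n * c := by
  refine (norm_sum_le _ _).trans ((Finset.sum_le_card_nsmul _ _ c ?_).trans ?_)
  · exact fun i hi => h i (Finset.mem_range.1 hi)
  · rw [Finset.card_range, nsmul_eq_mul]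
    have : (t : ℝ) ≤ n := by exact_mod_cast ht
    gcongr

theorem sum_range_eq_of_perm {n d : ℕ} {σ : ℕ → Fin n}
    (hσ : ((List.range n).map σ).Perm (List.finRange n)) (x : Fin n → Vec d) :
    ∑ i ∈ Finset.range n, x (σ i) = ∑ j, x j := by
  rw [Fin.sum_univ_def, ← (hσ.map x).sum_eq, List.map_map, Finset.sum_range, Fin.sum_univ_def,
    ← List.map_coe_finRange_eq_range, List.map_map]
  rfl

theorem exists_eq_map_range {n : ℕ} (hn : 0 < n) (l : List (Fin n)) (hl : l.length = n) :
    ∃ σ : ℕ → Fin n, l = (List.range n).map σ := by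
  refine ⟨fun i => l.getD i ⟨0, hn⟩, List.ext_getElem (by simp [hl]) fun i h1 h2 => ?_⟩
  simp [h1]

theorem prefix_sum_eq {n d t : ℕ} (ht : t ≤ n) (σ : ℕ → Fin n) (x : Fin n → Vec d) :
    ∃ p, p <+: (List.range n).map σ ∧ (p.map x).sum = ∑ i ∈ Finset.range t, x (σ i) := by
  refine ⟨(List.range t).map σ, (List.IsPrefix.map _ ?_), ?_⟩
  · rw [← Nat.add_sub_cancel' ht, List.range_add]
    exact List.prefix_append _ _
  · rw [List.map_map, Finset.sum_range, Fin.sum_univ_def, ← List.map_coe_finRange_eq_range,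
      List.map_map]
    rfl

section Epoch

variable {n d : ℕ} {f : Fin n → Vec d → ℝ} {L L2inf Linf : ℝ}

theorem norm_avg_gradient_sub_le (hn : 0 < n) (hf : Smooth f L L2inf Linf) (w v : Vec d) :
    ‖gradient (avgLoss f) w - gradient (avgLoss f) v‖ ≤ L2inf * supNorm (w - v) := by
  rw [gradient_avgLoss hf.differentiable, gradient_avgLoss hf.differentiable, avg_sub]
  exact norm_avg_le hn _ fun j => hf.lipschitz_two_sup j w v

theorem supNorm_avg_gradient_sub_le (hn : 0 < n) (hf : Smooth f L L2inf Linf) (w v : Vec d) :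
    supNorm (gradient (avgLoss f) w - gradient (avgLoss f) v) ≤ Linf * supNorm (w - v) := by
  rw [gradient_avgLoss hf.differentiable, gradient_avgLoss hf.differentiable, avg_sub]
  exact supNorm_avg_le hn _ fun j => hf.lipschitz_sup_sup j w v

/-- Used twice: with `v` the initial weight it bounds the error of the epoch as a gradient step,
with `v` the final weight it bounds the error of the next stale mean. -/
theorem norm_gradient_sub_mean_stepGrad_le (hn : 0 < n) (hf : Smooth f L L2inf Linf)
    (hL2 : 0 ≤ L2inf) {α : ℝ} {bal : SignRule d} {m w v : Vec d} {σ : ℕ → Fin n} {B : ℝ}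
    (hσ : ((List.range n).map σ).Perm (List.finRange n)) (hB0 : 0 ≤ B)
    (hB : ∀ t ≤ n, supNorm (v - (epochAt f α bal m w σ t).w) ≤ B) :
    ‖gradient (avgLoss f) v - (epochAt f α bal m w σ n).mNext‖ ≤ L2inf * B := by
  have hn' : (0 : ℝ) < n := by exact_mod_cast hn
  rw [gradient_avgLoss hf.differentiable, avg, ← sum_range_eq_of_perm hσ, epochAt_mNext,
    ← smul_sub, ← Finset.sum_sub_distrib, norm_smul, Real.norm_of_nonneg (by positivity),
    one_div, inv_mul_le_iff₀ hn']
  refine norm_sum_range_le le_rfl _ (by positivity) fun i hi => ?_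
  exact (hf.lipschitz_two_sup _ _ _).trans (mul_le_mul_of_nonneg_left (hB i hi.le) hL2)

theorem supNorm_gradient_sub_mean_stepGrad_le (hn : 0 < n) (hf : Smooth f L L2inf Linf)
    (hLinf : 0 ≤ Linf) {α : ℝ} {bal : SignRule d} {m w v : Vec d} {σ : ℕ → Fin n} {B : ℝ}
    (hσ : ((List.range n).map σ).Perm (List.finRange n)) (hB0 : 0 ≤ B)
    (hB : ∀ t ≤ n, supNorm (v - (epochAt f α bal m w σ t).w) ≤ B) :
    supNorm (gradient (avgLoss f) v - (epochAt f α bal m w σ n).mNext) ≤ Linf * B := by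
  have hn' : (0 : ℝ) < n := by exact_mod_cast hn
  rw [gradient_avgLoss hf.differentiable, avg, ← sum_range_eq_of_perm hσ, epochAt_mNext,
    ← smul_sub, ← Finset.sum_sub_distrib, supNorm_smul, abs_of_nonneg (by positivity),
    one_div, inv_mul_le_iff₀ hn']
  refine supNorm_sum_range_le le_rfl _ (by positivity) fun i hi => ?_
  exact (hf.lipschitz_sup_sup _ _ _).trans (mul_le_mul_of_nonneg_left (hB i hi.le) hLinf)

theorem supNorm_sign_smul (ε : ℤˣ) (x : Vec d) :
    supNorm (((ε : ℤ) : ℝ) • x) = supNorm x := by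
  rcases Int.units_eq_one_or ε with h | h <;> simp [h, supNorm_neg]

/-- One epoch with drift at most `D`: the new order is as good as the signed sums allow. -/
theorem supNorm_prefix_next_le (hn : 0 < n) (hf : Smooth f L L2inf Linf) (hL2 : 0 ≤ L2inf)
    (hLinf : 0 ≤ Linf) {ς A : ℝ} (hς : 0 < ς) (hg : BoundedGradientError f ς) {α : ℝ}
    {bal : SignRule d} (hbal : BalancingBound n A bal) {m w : Vec d} {σ : ℕ → Fin n} {H D : ℝ}
    (hσ : ((List.range n).map σ).Perm (List.finRange n)) (hD0 : 0 ≤ D)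
    (hH : ∀ t ≤ n, supNorm (∑ i ∈ Finset.range t, centredGrad f w (σ i)) ≤ H)
    (hD : ∀ t ≤ n, supNorm ((epochAt f α bal m w σ t).w - w) ≤ D) (p : List (Fin n))
    (hp : p <+: (epochAt f α bal m w σ n).left ++ (epochAt f α bal m w σ n).right) :
    supNorm (p.map (centredGrad f (epochAt f α bal m w σ n).w)).sum
      ≤ (H + A * (ς + L2inf * D + ‖gradient (avgLoss f) w - m‖)
        + n * (5 * Linf * D + supNorm (gradient (avgLoss f) w - m))) / 2 := by
  set v := (epochAt f α bal m w σ n).w with hv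
  have hcg (u : Vec d) (j : Fin n) : centredGrad f u j
      = gradient (f j) u - gradient (avgLoss f) u := by
    rw [gradient_avgLoss hf.differentiable]; rfl
  have hvw : supNorm (v - w) ≤ D := hD n le_rfl
  have hvt (t : ℕ) (ht : t ≤ n) : supNorm (v - (epochAt f α bal m w σ t).w) ≤ 2 * D := by
    have h1 := supNorm_sub_le (v - w) ((epochAt f α bal m w σ t).w - w)
    rw [sub_sub_sub_cancel_right] at h1
    linarith [hD t ht]
  have havg : supNorm (gradient (avgLoss f) v - gradient (avgLoss f) w) ≤ Linf * D :=
    (supNorm_avg_gradient_sub_le hn hf v w).trans (mul_le_mul_of_nonneg_left hvw hLinf)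
  have hzero : ∑ j, centredGrad f v j = 0 := sum_sub_avg hn _
  -- Moving the base point from `w` to `v` costs `Linf * D` per term for the example and again for
  -- the average.
  have hP (t : ℕ) (ht : t ≤ n) : supNorm (∑ i ∈ Finset.range t, centredGrad f v (σ i))
      ≤ H + n * (2 * Linf * D) := by
    have h1 : ∑ i ∈ Finset.range t, centredGrad f v (σ i)
        = ∑ i ∈ Finset.range t, centredGrad f w (σ i)
          + ∑ i ∈ Finset.range t, (centredGrad f v (σ i) - centredGrad f w (σ i)) := by
      rw [← Finset.sum_add_distrib]; simp
    rw [h1]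
    refine (supNorm_add_le _ _).trans (add_le_add (hH t ht) ?_)
    refine supNorm_sum_range_le ht _ (by positivity) fun i _ => ?_
    rw [hcg, hcg, sub_sub_sub_comm]
    have h2 := (hf.lipschitz_sup_sup (σ i) v w).trans (mul_le_mul_of_nonneg_left hvw hLinf)
    linarith [supNorm_sub_le (gradient (f (σ i)) v - gradient (f (σ i)) w)
      (gradient (avgLoss f) v - gradient (avgLoss f) w)]
  have hz (i : ℕ) (hi : i < n) : ‖stepGrad f α bal m w σ i - m‖
      ≤ ς + L2inf * D + ‖gradient (avgLoss f) w - m‖ := by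
    set u := (epochAt f α bal m w σ i).w with hu
    have h1 : ‖gradient (f (σ i)) u - gradient (avgLoss f) u‖ ≤ ς := by
      rw [gradient_avgLoss hf.differentiable]; exact hg (σ i) u
    have h2 := (norm_avg_gradient_sub_le hn hf u w).trans
      (mul_le_mul_of_nonneg_left (hD i hi.le) hL2)
    have h3 : stepGrad f α bal m w σ i - m = (gradient (f (σ i)) u - gradient (avgLoss f) u)
        + (gradient (avgLoss f) u - gradient (avgLoss f) w) + (gradient (avgLoss f) w - m) := by
      rw [stepGrad, ← hu]; abel
    rw [h3]
    exact norm_add₃_le.trans (by linarith)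
  have hQ (t : ℕ) (ht : t ≤ n) : supNorm (∑ i ∈ Finset.range t,
      (((stepSign f α bal m w σ i : ℤˣ) : ℤ) : ℝ) • centredGrad f v (σ i))
      ≤ A * (ς + L2inf * D + ‖gradient (avgLoss f) w - m‖)
        + n * (3 * Linf * D + supNorm (gradient (avgLoss f) w - m)) := by
    -- The rule balanced `stepGrad - m`, not the centred gradients at `v`; the discrepancy enters
    -- termwise, where the signs do not matter.
    have h1 : ∑ i ∈ Finset.range t,
        (((stepSign f α bal m w σ i : ℤˣ) : ℤ) : ℝ) • centredGrad f v (σ i)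
        = (epochAt f α bal m w σ t).s + ∑ i ∈ Finset.range t,
          (((stepSign f α bal m w σ i : ℤˣ) : ℤ) : ℝ)
            • (centredGrad f v (σ i) - (stepGrad f α bal m w σ i - m)) := by
      rw [epochAt_s_eq_sum, ← Finset.sum_add_distrib]
      simp [← smul_add]
    rw [h1]
    refine (supNorm_add_le _ _).trans (add_le_add ?_ ?_)
    · rw [epochAt_s_eq_signedSum]
      exact hbal _ (by positivity) _ hz t ht
    · refine supNorm_sum_range_le ht _ (by
        have := supNorm_nonneg (gradient (avgLoss f) w - m)
        positivity) fun i hi => ?_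
      rw [supNorm_sign_smul, hcg]
      have h2 : supNorm (gradient (f (σ i)) v - stepGrad f α bal m w σ i) ≤ Linf * (2 * D) :=
        (hf.lipschitz_sup_sup _ _ _).trans
          (mul_le_mul_of_nonneg_left (hvt i (by omega)) hLinf)
      have h3 : gradient (f (σ i)) v - gradient (avgLoss f) v - (stepGrad f α bal m w σ i - m)
          = (gradient (f (σ i)) v - stepGrad f α bal m w σ i)
            - (gradient (avgLoss f) v - gradient (avgLoss f) w)
            - (gradient (avgLoss f) w - m) := by abel
      rw [h3]
      refine (supNorm_sub_le _ _).trans ?_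
      linarith [supNorm_sub_le (gradient (f (σ i)) v - stepGrad f α bal m w σ i)
        (gradient (avgLoss f) v - gradient (avgLoss f) w)]
  refine (supNorm_prefix_reorder_le f α bal m w σ _ hσ hzero hP hQ p hp).trans (le_of_eq ?_)
  ring

/-- What is known at the beginning of an epoch: the prefix sums of the centred gradients are at
most `H`, and the error of the stale mean is controlled by `E`. -/
structure EpochBound (f : Fin n → Vec d → ℝ) (A α : ℝ) (r : RunState n d) (H E : ℝ) : Prop where
  perm : r.order.Perm (List.finRange n)
  prefix_le : ∀ p, p <+: r.order → supNorm (p.map (centredGrad f r.w)).sum ≤ H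
  stale_le : α * (A * ‖gradient (avgLoss f) r.w - r.m‖
    + n * supNorm (gradient (avgLoss f) r.w - r.m)) ≤ 11 / 130 * E

theorem EpochBound.nonneg {A α : ℝ} {r : RunState n d} {H E : ℝ}
    (h : EpochBound f A α r H E) : 0 ≤ H := by
  simpa [supNorm_zero] using h.prefix_le [] List.nil_prefix

/-- The bounds at the end of an epoch, and the progress made in it. -/
theorem EpochBound.runEpoch (hn : 0 < n) (hf : Smooth f L L2inf Linf) (hL2 : 0 < L2inf)
    (hLinf : 0 < Linf) {ς A : ℝ} (hς : 0 < ς) (hA : 0 < A) (hg : BoundedGradientError f ς) {α : ℝ}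
    (hα : 0 ≤ α) (hαL : α * (n * L) ≤ 1) (hαL2 : α * (26 * (n + A) * L2inf) ≤ 1)
    (hαLinf : α * (260 * n * Linf) ≤ 1) {bal : SignRule d} (hbal : BalancingBound n A bal)
    {r : RunState n d} {H E : ℝ} (hr : EpochBound f A α r H E) {D : ℝ}
    (hD : D = 260 / 259 * (α * H + α * n * ‖gradient (avgLoss f) r.w‖)) :
    (∃ H', EpochBound f A α (runEpoch f α bal r) H' D ∧
      α * H' ≤ α * H / 2 + α * A * ς / 2 + 3 / 104 * D + 11 / 260 * E) ∧
    avgLoss f (runEpoch f α bal r).w ≤ avgLoss f r.w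
      - α * n / 2 * ‖gradient (avgLoss f) r.w‖ ^ 2 + α * n / 2 * (L2inf * D) ^ 2 := by
  have hn' : (0 : ℝ) < n := by exact_mod_cast hn
  have hH0 := hr.nonneg
  have hD0 : 0 ≤ D := by rw [hD]; positivity
  obtain ⟨w, m, order⟩ := r
  obtain ⟨hperm, hpre, hstale⟩ := hr
  dsimp only at *
  obtain ⟨σ, rfl⟩ := exists_eq_map_range hn order (by simpa using hperm.length_eq)
  have hrun : GraB.runEpoch f α bal ⟨w, m, (List.range n).map σ⟩
      = ⟨(epochAt f α bal m w σ n).w, (epochAt f α bal m w σ n).mNext,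
        (epochAt f α bal m w σ n).left ++ (epochAt f α bal m w σ n).right⟩ := by
    simp only [GraB.runEpoch, foldl_epochStep]
  have hH (t : ℕ) (ht : t ≤ n) :
      supNorm (∑ i ∈ Finset.range t, centredGrad f w (σ i)) ≤ H := by
    obtain ⟨p, hp, hps⟩ := prefix_sum_eq ht σ (centredGrad f w)
    rw [← hps]
    exact hpre p hp
  -- The self-referential drift bound closes because `α * n * Linf ≤ 1 / 260`; hence the factor `260
  -- / 259 = 1 / (1 - 1 / 260)` in `D`.
  have hdrift := supNorm_epochAt_w_sub_le (bal := bal) (m := m) hα hLinf.le hD0 hf hH (D := D) (by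
    have : α * (260 * n * Linf) * D ≤ 1 * D := by gcongr
    linarith)
  have hdrift' (t : ℕ) (ht : t ≤ n) : supNorm (w - (epochAt f α bal m w σ t).w) ≤ D := by
    rw [supNorm_sub_comm]; exact hdrift t ht
  have hdrift2 (t : ℕ) (ht : t ≤ n) : supNorm ((epochAt f α bal m w σ n).w
      - (epochAt f α bal m w σ t).w) ≤ 2 * D := by
    have h1 := supNorm_sub_le ((epochAt f α bal m w σ n).w - w)
      ((epochAt f α bal m w σ t).w - w)
    rw [sub_sub_sub_cancel_right] at h1
    linarith [hdrift t ht, hdrift n le_rfl]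
  have hαL2D : α * (26 * (n + A) * L2inf) * D ≤ 1 * D := by gcongr
  have hαAL2D : α * (26 * A * L2inf) * D ≤ 1 * D := by
    have : 0 ≤ α * (26 * n * L2inf) * D := by positivity
    linarith
  have hαLinfD : α * (260 * n * Linf) * D ≤ 1 * D := by gcongr
  rw [hrun]
  refine ⟨⟨_, ⟨?_, fun p hp => supNorm_prefix_next_le hn hf hL2.le hLinf.le hς hg hbal hperm hD0
    hH hdrift p hp, ?_⟩, ?_⟩, ?_⟩
  · exact (left_append_right_perm ..).trans hperm
  · have h1 := norm_gradient_sub_mean_stepGrad_le hn hf hL2.le hperm (by positivity) hdrift2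
    have h2 := supNorm_gradient_sub_mean_stepGrad_le hn hf hLinf.le hperm (by positivity) hdrift2
    dsimp only
    calc _ ≤ α * (A * (L2inf * (2 * D)) + n * (Linf * (2 * D))) := by gcongr
      _ ≤ _ := by linarith
  · linarith
  · have h1 := norm_gradient_sub_mean_stepGrad_le hn hf hL2.le hperm hD0 hdrift'
    have h2 := avgLoss_step_le hf w _ (γ := α * n) (by positivity) (by linarith) h1
    -- The next stale mean is exactly the direction of the whole epoch.
    have h3 : (epochAt f α bal m w σ n).w = w - (α * n) • (epochAt f α bal m w σ n).mNext := by
      rw [epochAt_mNext, smul_smul, epochAt_w]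
      field_simp
    rw [← h3] at h2
    exact h2

end Epoch

end GraB

namespace GraB

/-! ### The potential -/

/-- Here `x = α * H`, `y = α * n * ‖∇f(w)‖` and `S = α * A * ς`. Halving `x` leaves enough room for
the penalty to shrink by a factor `9 / 10` and still absorb the descent error `D ^ 2 / 2`. -/
theorem potential_inequality {x x' y S D E η : ℝ} (hx' : 0 ≤ x')
    (hD : D = 260 / 259 * (x + y))
    (h : x' ≤ x / 2 + S / 2 + 3 / 104 * D + 11 / 260 * E) (hη : η ≤ 1 / 10) :
    3 * x' ^ 2 + 3 / 50 * D ^ 2 + 1 / 2 * D ^ 2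
      ≤ (1 - η) * (3 * x ^ 2 + 3 / 50 * E ^ 2) + 3 * S ^ 2 + 6 / 5 * y ^ 2 := by
  have h1 : x' ^ 2 ≤ (x / 2 + S / 2 + 3 / 104 * D + 11 / 260 * E) ^ 2 := by gcongr
  have h2 : (x / 2 + S / 2 + 3 / 104 * D + 11 / 260 * E) ^ 2
      ≤ x ^ 2 / 2 + S ^ 2 + 8 * (3 / 104) ^ 2 * D ^ 2 + 8 * (11 / 260) ^ 2 * E ^ 2 := by
    nlinarith [sq_nonneg (x / 2 - (S / 2 + 3 / 104 * D + 11 / 260 * E)),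
      sq_nonneg (S / 2 - (3 / 104 * D + 11 / 260 * E)),
      sq_nonneg (3 / 104 * D - 11 / 260 * E)]
  have h3 : D ^ 2 ≤ 2 * (260 / 259) ^ 2 * (x ^ 2 + y ^ 2) := by
    rw [hD]
    nlinarith [sq_nonneg (x - y)]
  have h4 : η * (3 * x ^ 2 + 3 / 50 * E ^ 2) ≤ 1 / 10 * (3 * x ^ 2 + 3 / 50 * E ^ 2) := by
    gcongr
  nlinarith [sq_nonneg x, sq_nonneg y, sq_nonneg E]

/-! ### Iterating the estimate over the epochs. -/

section Run

variable {n d : ℕ} {f : Fin n → Vec d → ℝ} {L L2inf Linf ς A α : ℝ}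

/-- The suboptimality, with a penalty for the bounds at the beginning of an epoch. -/
noncomputable def potential (f : Fin n → Vec d → ℝ) (L2inf α : ℝ) (w : Vec d) (H E : ℝ) : ℝ :=
  avgLoss f w - fStar f + α * n * L2inf ^ 2 * (3 * (α * H) ^ 2 + 3 / 50 * E ^ 2)

theorem suboptimality_le_potential (hα : 0 ≤ α) (w : Vec d) (H E : ℝ) :
    avgLoss f w - fStar f ≤ potential f L2inf α w H E := by
  rw [potential]
  have : 0 ≤ α * n * L2inf ^ 2 * (3 * (α * H) ^ 2 + 3 / 50 * E ^ 2) := by positivity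
  linarith

/-- The descent `α * n / 2 * ‖∇f(w)‖ ^ 2` is shared: the part `1 / 2 - κ` pays for contracting the
suboptimality, `1 / 100` covers the gradient part of the drift, and the rest remains. -/
theorem potential_step (hn : 0 < n) (hf : Smooth f L L2inf Linf) (hL2 : 0 < L2inf)
    (hLinf : 0 < Linf) (hς : 0 < ς) (hA : 0 < A) (hg : BoundedGradientError f ς)
    (hα : 0 ≤ α) (hαL : α * (n * L) ≤ 1) (hαL2 : α * (26 * (n + A) * L2inf) ≤ 1)
    (hαLinf : α * (260 * n * Linf) ≤ 1) {bal : SignRule d} (hbal : BalancingBound n A bal)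
    {r : RunState n d} {H E : ℝ} (hr : EpochBound f A α r H E) {η κ : ℝ} (hη : η ≤ 1 / 10)
    (hκ : η * (avgLoss f r.w - fStar f)
      ≤ α * n * (1 / 2 - κ) * ‖gradient (avgLoss f) r.w‖ ^ 2) :
    ∃ H' E', EpochBound f A α (runEpoch f α bal r) H' E' ∧
      potential f L2inf α (runEpoch f α bal r).w H' E' ≤ (1 - η) * potential f L2inf α r.w H E
        - α * n * (κ - 1 / 100) * ‖gradient (avgLoss f) r.w‖ ^ 2
        + 3 * (α * n) * (L2inf * (α * A * ς)) ^ 2 := by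
  obtain ⟨⟨H', hr', hH'⟩, hdec⟩ :=
    hr.runEpoch hn hf hL2 hLinf hς hA hg hα hαL hαL2 hαLinf hbal rfl
  refine ⟨H', _, hr', ?_⟩
  set N := ‖gradient (avgLoss f) r.w‖
  set D := 260 / 259 * (α * H + α * n * N) with hD
  have hx' : 0 ≤ α * H' := mul_nonneg hα hr'.nonneg
  have h1 := potential_inequality (y := α * n * N) (S := α * A * ς) (E := E) hx'
    hD (by linarith) hη
  have h2 := mul_le_mul_of_nonneg_left h1 (show 0 ≤ α * n * L2inf ^ 2 by positivity)
  have h3 : α * n * L2inf ≤ 1 / 26 := by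
    have : 0 ≤ α * (26 * A * L2inf) := by positivity
    linarith
  have h4 : (α * n * L2inf) ^ 2 ≤ (1 / 26) ^ 2 := by gcongr
  have h5 : α * n * N ^ 2 * (α * n * L2inf) ^ 2 ≤ α * n * N ^ 2 * (1 / 26) ^ 2 := by gcongr
  have h6 : 0 ≤ α * n * N ^ 2 := by positivity
  rw [potential, potential]
  linarith

theorem centredGrad_norm_le (hg : BoundedGradientError f ς) (w : Vec d) (j : Fin n) :
    ‖centredGrad f w j‖ ≤ ς := hg j w

/-- No order is assumed good at the start, so `H` is the trivial bound. The stale mean is `0`, so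
its error is the gradient itself, which `potential_zero_le` charges to the suboptimality. -/
theorem epochBound_zero (hn : 0 < n) (hL2 : 0 < L2inf) (hς : 0 < ς)
    (hg : BoundedGradientError f ς) (hα : 0 ≤ α)
    (hαL2 : α * (26 * (n + A) * L2inf) ≤ 1) (bal : ℕ → SignRule d) (w₁ : Vec d)
    (σ₁ : Equiv.Perm (Fin n)) :
    EpochBound f A α (run f α bal w₁ σ₁ 0) (n * ς)
      (‖gradient (avgLoss f) w₁‖ / (2 * L2inf)) where
  perm := by
    rw [run, List.ofFn_eq_map]
    exact Equiv.Perm.map_finRange_perm σ₁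
  prefix_le p hp := by
    have hlen : p.length ≤ n := by simpa [run] using hp.length_le
    obtain ⟨σ, hσ⟩ : ∃ σ : ℕ → Fin n, p = (List.range p.length).map σ := by
      refine ⟨fun i => p.getD i ⟨0, hn⟩, List.ext_getElem (by simp) fun i h1 h2 => ?_⟩
      simp [h1]
    obtain ⟨t, ht⟩ : ∃ t, t = p.length := ⟨_, rfl⟩
    rw [← ht] at hlen hσ
    have hsum : (p.map (centredGrad f (run f α bal w₁ σ₁ 0).w)).sum
        = ∑ i ∈ Finset.range t, centredGrad f (run f α bal w₁ σ₁ 0).w (σ i) := by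
      rw [hσ, List.map_map, Finset.sum_range, Fin.sum_univ_def,
        ← List.map_coe_finRange_eq_range, List.map_map]
      rfl
    rw [hsum]
    exact supNorm_sum_range_le hlen _ hς.le fun i _ =>
      (supNorm_le_norm _).trans (centredGrad_norm_le hg _ _)
  stale_le := by
    simp only [run, sub_zero]
    set N := ‖gradient (avgLoss f) w₁‖ with hN
    have h1 : supNorm (gradient (avgLoss f) w₁) ≤ N := supNorm_le_norm _
    have h2 : α * (26 * (n + A) * L2inf) * N ≤ 1 * N := by gcongr
    have h0 : 0 ≤ N := norm_nonneg _
    calc α * (A * N + n * supNorm (gradient (avgLoss f) w₁)) ≤ α * (A * N + n * N) := by gcongr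
      _ ≤ 11 / 130 * (N / (2 * L2inf)) := by
        rw [← mul_div_assoc, le_div_iff₀ (by positivity)]
        linarith

theorem potential_zero_le (hf : Smooth f L L2inf Linf)
    (hb : BddBelow (Set.range (avgLoss f))) (hL : 0 < L) (hL2 : 0 < L2inf)
    (hA : 0 ≤ A) (hα : 0 ≤ α) (hαL : α * (n * L) ≤ 1)
    (hαL2 : α * (26 * (n + A) * L2inf) ≤ 1) (w₁ : Vec d) :
    potential f L2inf α w₁ (n * ς) (‖gradient (avgLoss f) w₁‖ / (2 * L2inf))
      ≤ 103 / 100 * (avgLoss f w₁ - fStar f) + α * n * (3 / 676) * ς ^ 2 := by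
  have hF := sub_nonneg.2 (fStar_le hb w₁)
  have h1 := norm_gradient_sq_le hL hb hf w₁
  set F := avgLoss f w₁ - fStar f with hFdef
  set N := ‖gradient (avgLoss f) w₁‖
  have h3 : α * n * L2inf ≤ 1 / 26 := by
    have : 0 ≤ α * (26 * A * L2inf) := by positivity
    linarith
  have h4 : (α * n * L2inf) ^ 2 ≤ (1 / 26) ^ 2 := by gcongr
  have h5 : α * n * ς ^ 2 * (α * n * L2inf) ^ 2 ≤ α * n * ς ^ 2 * (1 / 26) ^ 2 := by gcongr
  have h6 : α * n * N ^ 2 ≤ α * n * (2 * L * F) := by gcongr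
  have h7 : α * (n * L) * F ≤ 1 * F := by gcongr
  have h8 : L2inf ^ 2 * (3 / 50 * (N / (2 * L2inf)) ^ 2) = 3 / 200 * N ^ 2 := by
    field_simp
    ring
  have h9 : α * n * L2inf ^ 2 * (3 * (α * (n * ς)) ^ 2 + 3 / 50 * (N / (2 * L2inf)) ^ 2)
      = 3 * (α * n * ς ^ 2 * (α * n * L2inf) ^ 2)
        + α * n * (L2inf ^ 2 * (3 / 50 * (N / (2 * L2inf)) ^ 2)) := by ring
  rw [potential, h9, h8, ← hFdef]
  linarith

theorem sum_norm_gradient_sq_le (hn : 0 < n) (hf : Smooth f L L2inf Linf)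
    (hb : BddBelow (Set.range (avgLoss f))) (hL : 0 < L) (hL2 : 0 < L2inf)
    (hLinf : 0 < Linf) (hς : 0 < ς) (hA : 0 < A) (hg : BoundedGradientError f ς)
    (hα : 0 ≤ α) (hαL : α * (n * L) ≤ 1) (hαL2 : α * (26 * (n + A) * L2inf) ≤ 1)
    (hαLinf : α * (260 * n * Linf) ≤ 1) {bal : ℕ → SignRule d}
    (hbal : ∀ k, BalancingBound n A (bal k)) (w₁ : Vec d) (σ₁ : Equiv.Perm (Fin n)) (k : ℕ) :
    avgLoss f (run f α bal w₁ σ₁ k).w - fStar f + α * n * (49 / 100) *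
        ∑ i ∈ Finset.range k, ‖gradient (avgLoss f) (run f α bal w₁ σ₁ i).w‖ ^ 2
      ≤ 103 / 100 * (avgLoss f w₁ - fStar f) + α * n * (3 / 676) * ς ^ 2
        + k * (3 * (α * n) * (L2inf * (α * A * ς)) ^ 2) := by
  have key : ∃ H E, EpochBound f A α (run f α bal w₁ σ₁ k) H E ∧
      potential f L2inf α (run f α bal w₁ σ₁ k).w H E + α * n * (49 / 100) *
        ∑ i ∈ Finset.range k, ‖gradient (avgLoss f) (run f α bal w₁ σ₁ i).w‖ ^ 2
      ≤ 103 / 100 * (avgLoss f w₁ - fStar f) + α * n * (3 / 676) * ς ^ 2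
        + k * (3 * (α * n) * (L2inf * (α * A * ς)) ^ 2) := by
    induction k with
    | zero =>
      refine ⟨_, _, epochBound_zero hn hL2 hς hg hα hαL2 bal w₁ σ₁, ?_⟩
      simpa [run] using potential_zero_le hf hb hL hL2 hA.le hα hαL hαL2 w₁
    | succ k ih =>
      obtain ⟨H, E, hr, hV⟩ := ih
      obtain ⟨H', E', hr', hV'⟩ := potential_step hn hf hL2 hLinf hς hA hg hα hαL hαL2 hαLinf
        (hbal (k + 1)) hr (η := 0) (κ := 1 / 2) (by norm_num) (by simp)
      refine ⟨H', E', hr', ?_⟩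
      rw [Finset.sum_range_succ]
      push_cast
      rw [run]
      linarith
  obtain ⟨H, E, -, h⟩ := key
  linarith [suboptimality_le_potential (f := f) (L2inf := L2inf) hα
    (run f α bal w₁ σ₁ k).w H E]

theorem suboptimality_le_of_polyakLojasiewicz (hn : 0 < n) (hf : Smooth f L L2inf Linf)
    (hb : BddBelow (Set.range (avgLoss f))) (hL : 0 < L) (hL2 : 0 < L2inf)
    (hLinf : 0 < Linf) (hς : 0 < ς) (hA : 0 < A) (hg : BoundedGradientError f ς)
    (hα : 0 ≤ α) (hαL : α * (n * L) ≤ 1) (hαL2 : α * (26 * (n + A) * L2inf) ≤ 1)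
    (hαLinf : α * (260 * n * Linf) ≤ 1) {μ : ℝ} (hμ : 0 < μ) (hαμ : α * n * μ / 2 ≤ 1 / 10)
    (hPL : PolyakLojasiewicz f μ) {bal : ℕ → SignRule d}
    (hbal : ∀ k, BalancingBound n A (bal k)) (w₁ : Vec d) (σ₁ : Equiv.Perm (Fin n)) (k : ℕ) :
    avgLoss f (run f α bal w₁ σ₁ k).w - fStar f
      ≤ (1 - α * n * μ / 2) ^ k *
          (103 / 100 * (avgLoss f w₁ - fStar f) + α * n * (3 / 676) * ς ^ 2)
        + 6 * (L2inf * (α * A * ς)) ^ 2 / μ := by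
  -- `R` is the fixed point of the recursion: the noise of an epoch equals `α * n * μ / 2 * R`.
  set R := 6 * (L2inf * (α * A * ς)) ^ 2 / μ with hR
  have hRμ : R * μ = 6 * (L2inf * (α * A * ς)) ^ 2 := by rw [hR]; field_simp
  have key : ∃ H E, EpochBound f A α (run f α bal w₁ σ₁ k) H E ∧
      potential f L2inf α (run f α bal w₁ σ₁ k).w H E ≤ (1 - α * n * μ / 2) ^ k *
          (103 / 100 * (avgLoss f w₁ - fStar f) + α * n * (3 / 676) * ς ^ 2) + R := by
    induction k with
    | zero =>
      refine ⟨_, _, epochBound_zero hn hL2 hς hg hα hαL2 bal w₁ σ₁, ?_⟩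
      have h1 := potential_zero_le (ς := ς) hf hb hL hL2 hA.le hα hαL hαL2 w₁
      have h2 : 0 ≤ R := by positivity
      rw [pow_zero, one_mul]
      exact h1.trans (by linarith)
    | succ k ih =>
      obtain ⟨H, E, hr, hV⟩ := ih
      obtain ⟨H', E', hr', hV'⟩ := potential_step hn hf hL2 hLinf hς hA hg hα hαL hαL2 hαLinf
        (hbal (k + 1)) hr (η := α * n * μ / 2) (κ := 1 / 4) hαμ (by
          have h1 := mul_le_mul_of_nonneg_left (hPL (run f α bal w₁ σ₁ k).w)
            (show 0 ≤ α * n / 2 by positivity)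
          linarith)
      refine ⟨H', E', hr', ?_⟩
      have h2 := mul_le_mul_of_nonneg_left hV (show 0 ≤ 1 - α * n * μ / 2 by linarith)
      have h3 : 0 ≤ α * n * (1 / 4 - 1 / 100)
          * ‖gradient (avgLoss f) (run f α bal w₁ σ₁ k).w‖ ^ 2 := by
        have : 0 ≤ α * n := by positivity
        have h4 : (0 : ℝ) ≤ 1 / 4 - 1 / 100 := by norm_num
        positivity
      have h4 : 3 * (α * n) * (L2inf * (α * A * ς)) ^ 2 = α * n * μ / 2 * R := by
        rw [hR]; field_simp; ring
      rw [h4] at hV'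
      rw [run, pow_succ']
      linarith
  obtain ⟨H, E, -, h⟩ := key
  exact (suboptimality_le_potential hα _ H E).trans h

end Run

end GraB

namespace GraB

/-! ### The step sizes -/

theorem lambertW0_spec {x : ℝ} (hx : 0 ≤ x) :
    0 ≤ lambertW0 x ∧ lambertW0 x * Real.exp (lambertW0 x) = x := by
  have hex : ∃ y ∈ Set.Ici (-1 : ℝ), y * Real.exp y = x := by
    have hc : ContinuousOn (fun y : ℝ => y * Real.exp y) (Set.Icc 0 x) := by fun_prop
    obtain ⟨y, hy, hyx⟩ := intermediate_value_Icc hx hc (show x ∈ Set.Icc _ _ from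
      ⟨by simpa using hx, by nlinarith [Real.add_one_le_exp x]⟩)
    exact ⟨y, by have := hy.1; simp only [Set.mem_Ici]; linarith, hyx⟩
  have heq : lambertW0 x * Real.exp (lambertW0 x) = x :=
    Function.invFunOn_eq (f := fun y : ℝ => y * Real.exp y) hex
  refine ⟨?_, heq⟩
  by_contra! h
  have := mul_neg_of_neg_of_pos h (Real.exp_pos (lambertW0 x))
  linarith

/-- Multiplying `1 - W ≤ exp (-W)` by `exp W` gives `exp W ≤ 1 + W * exp W = 1 + x`. -/
theorem lambertW0_le_log {x : ℝ} (hx : 0 ≤ x) : lambertW0 x ≤ Real.log (1 + x) := by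
  obtain ⟨h0, h1⟩ := lambertW0_spec hx
  rw [Real.le_log_iff_exp_le (by linarith)]
  have h2 := Real.one_sub_le_exp_neg (lambertW0 x)
  have h3 := mul_le_mul_of_nonneg_right h2 (Real.exp_pos (lambertW0 x)).le
  rw [← Real.exp_add, neg_add_cancel, Real.exp_zero] at h3
  linarith

theorem tendsto_lambertW0_div {c : ℝ} (hc : 0 ≤ c) :
    Filter.Tendsto (fun K : ℕ => lambertW0 (c * (K : ℝ) ^ 2) / K) Filter.atTop (nhds 0) := by
  have hlog : Filter.Tendsto (fun K : ℕ => Real.log K / K) Filter.atTop (nhds 0) :=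
    (Real.isLittleO_log_id_atTop.tendsto_div_nhds_zero).comp tendsto_natCast_atTop_atTop
  have hinv : Filter.Tendsto (fun K : ℕ => Real.log (1 + c) / (K : ℝ)) Filter.atTop (nhds 0) :=
    tendsto_const_div_atTop_nhds_zero_nat _
  have hsum : Filter.Tendsto (fun K : ℕ => Real.log (1 + c) / (K : ℝ) + 2 * (Real.log K / K))
      Filter.atTop (nhds 0) := by simpa using hinv.add (hlog.const_mul 2)
  refine squeeze_zero' (Filter.Eventually.of_forall fun K => ?_) ?_ hsum
  · exact div_nonneg (lambertW0_spec (by positivity)).1 (Nat.cast_nonneg K)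
  · filter_upwards [Filter.eventually_ge_atTop 1] with K hK
    have hK' : (1 : ℝ) ≤ K := by exact_mod_cast hK
    have h1 : Real.log (1 + c * (K : ℝ) ^ 2) ≤ Real.log ((1 + c) * (K : ℝ) ^ 2) := by
      apply Real.log_le_log (by positivity)
      nlinarith
    rw [Real.log_mul (by positivity) (by positivity), Real.log_pow] at h1
    have h2 := lambertW0_le_log (x := c * (K : ℝ) ^ 2) (by positivity)
    rw [← mul_div_assoc, ← add_div]
    gcongr
    push_cast at h1
    linarith

/-! ### Inserting the step sizes. -/

theorem one_div_min_le {a b : ℝ} (ha : 0 < a) (hb : 0 < b) :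
    1 / min a b ≤ 1 / a + 1 / b := by
  have h1 : 0 < 1 / a := by positivity
  have h2 : 0 < 1 / b := by positivity
  rcases min_choice a b with h | h <;> rw [h] <;> linarith

theorem sum_Icc_one_sub_one (g : ℕ → ℝ) (K : ℕ) :
    ∑ k ∈ Finset.Icc 1 K, g (k - 1) = ∑ k ∈ Finset.range K, g k := by
  induction K with
  | zero => simp
  | succ K ih => rw [Finset.sum_Icc_succ_top (by omega), ih, Finset.sum_range_succ]; simp

/-- The estimate of the step size in the non-convex case. -/
theorem nonconvex_bound {n K A ς L L2inf Linf F a α : ℝ} (hn : 0 < n) (hK : 0 < K) (hA : 0 < A)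
    (hς : 0 < ς) (hL : 0 < L) (hL2 : 0 < L2inf) (hLinf : 0 < Linf) (hF : 0 < F)
    (ha : a = (F / (32 * n * A ^ 2 * ς ^ 2 * L2inf ^ 2 * K)) ^ ((1 : ℝ) / 3))
    (hα : α = min a (min (1 / (n * L))
      (min (1 / (26 * (n + A) * L2inf)) (1 / (260 * n * Linf))))) :
    211 / 100 * (F / (α * n * K)) + 613 / 100 * (L2inf * (α * A * ς)) ^ 2
      ≤ 11 * (A ^ 2 * ς ^ 2 * L2inf ^ 2 * F ^ 2 / (n ^ 2 * K ^ 2)) ^ ((1 : ℝ) / 3)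
        + 1040 * (F * (L + L2inf + Linf)) / K + 104 * F * A * L2inf / (n * K) := by
  set Y := (A ^ 2 * ς ^ 2 * L2inf ^ 2 * F ^ 2 / (n ^ 2 * K ^ 2)) ^ ((1 : ℝ) / 3) with hY
  have cube (x : ℝ) (hx : 0 ≤ x) : (x ^ ((1 : ℝ) / 3)) ^ 3 = x := by
    rw [← Real.rpow_natCast, ← Real.rpow_mul hx]; norm_num
  have ha0 : 0 < a := by rw [ha]; positivity
  have hY0 : 0 < Y := by rw [hY]; positivity
  have ha3 : a ^ 3 = F / (32 * n * A ^ 2 * ς ^ 2 * L2inf ^ 2 * K) := by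
    rw [ha]; exact cube _ (by positivity)
  have hY3 : Y ^ 3 = A ^ 2 * ς ^ 2 * L2inf ^ 2 * F ^ 2 / (n ^ 2 * K ^ 2) :=
    cube _ (by positivity)
  have hα0 : 0 < α := by
    rw [hα]
    refine lt_min ha0 (lt_min ?_ (lt_min ?_ ?_)) <;> positivity
  have hαa : α ≤ a := by rw [hα]; exact min_le_left _ _
  -- Compared through cubes: `3.2 ^ 3 > 32` here, and `1 / 1000 > 1 / 1024` for the noise term
  -- below.
  have h1 : F / (a * n * K) ≤ 32 / 10 * Y := by
    rw [← pow_le_pow_iff_left₀ (by positivity) (by positivity) (show 3 ≠ 0 by norm_num)]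
    have : (F / (a * n * K)) ^ 3 = 32 * Y ^ 3 := by
      rw [div_pow, mul_pow, mul_pow, ha3, hY3]
      field_simp
    rw [this, mul_pow]
    have : 0 < Y ^ 3 := by positivity
    linarith
  have h2 : (L2inf * (α * A * ς)) ^ 2 ≤ 1 / 10 * Y := by
    have h3 : (L2inf * (α * A * ς)) ^ 2 ≤ (L2inf * (a * A * ς)) ^ 2 := by gcongr
    refine h3.trans ?_
    rw [← pow_le_pow_iff_left₀ (by positivity) (by positivity) (show 3 ≠ 0 by norm_num)]
    have : ((L2inf * (a * A * ς)) ^ 2) ^ 3 = 1 / 1024 * Y ^ 3 := by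
      calc _ = L2inf ^ 6 * (a ^ 3) ^ 2 * A ^ 6 * ς ^ 6 := by ring
        _ = _ := by
          rw [ha3, hY3]
          field_simp
          norm_num
    rw [this, mul_pow]
    have : 0 < Y ^ 3 := by positivity
    linarith
  have h3 : 1 / α ≤ 1 / a + (n * L + (26 * (n + A) * L2inf + 260 * n * Linf)) := by
    rw [hα]
    refine (one_div_min_le ha0 (by positivity)).trans (add_le_add le_rfl ?_)
    refine (one_div_min_le (by positivity) (by positivity)).trans (add_le_add (by simp) ?_)
    refine (one_div_min_le (by positivity) (by positivity)).trans (le_of_eq ?_)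
    simp only [one_div, inv_inv]
  have h4 : F / (α * n * K) ≤ F / (a * n * K) + F * L / K + 26 * (F * L2inf / K)
      + 26 * (F * A * L2inf / (n * K)) + 260 * (F * Linf / K) := by
    have h5 := mul_le_mul_of_nonneg_left h3 (show 0 ≤ F / (n * K) by positivity)
    calc F / (α * n * K) = F / (n * K) * (1 / α) := by field_simp
      _ ≤ _ := h5
      _ = _ := by field_simp; ring
  have p1 : 0 < F * L / K := by positivity
  have p2 : 0 < F * L2inf / K := by positivity
  have p3 : 0 < F * A * L2inf / (n * K) := by positivity
  have p4 : 0 < F * Linf / K := by positivity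
  have e1 : 1040 * (F * (L + L2inf + Linf)) / K
      = 1040 * (F * L / K) + 1040 * (F * L2inf / K) + 1040 * (F * Linf / K) := by ring
  have e2 : 104 * F * A * L2inf / (n * K) = 104 * (F * A * L2inf / (n * K)) := by ring
  rw [e1, e2]
  linarith

theorem nonconvex_rate {n d K : ℕ} {A ς L L2inf Linf : ℝ} (hn : 0 < n) (hK : 0 < K) (hA : 0 < A)
    (hς : 0 < ς) (hL : 0 < L) (hL2 : 0 < L2inf) (hLinf : 0 < Linf) {f : Fin n → Vec d → ℝ}
    {bal : ℕ → SignRule d} (w₁ : Vec d) (σ₁ : Equiv.Perm (Fin n)) {F α : ℝ}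
    (hb : BddBelow (Set.range (avgLoss f))) (hf : Smooth f L L2inf Linf)
    (hg : BoundedGradientError f ς) (hbal : ∀ k, BalancingBound n A (bal k))
    (hF : F = avgLoss f w₁ - fStar f) (hα : α = stepNonconvex n K A ς L L2inf Linf F) :
    (1 / (K : ℝ)) * ∑ k ∈ Finset.Icc 1 K, ‖gradient (avgLoss f) (weight f α bal w₁ σ₁ k)‖ ^ 2
      ≤ 11 * (A ^ 2 * ς ^ 2 * L2inf ^ 2 * F ^ 2 / ((n : ℝ) ^ 2 * (K : ℝ) ^ 2)) ^ ((1 : ℝ) / 3)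
        + ς ^ 2 / K + 1040 * (F * (L + L2inf + Linf)) / K
        + 104 * F * A * L2inf / (n * K) := by
  have hn' : (0 : ℝ) < n := by exact_mod_cast hn
  have hK' : (0 : ℝ) < K := by exact_mod_cast hK
  have hF0 : 0 ≤ F := hF ▸ sub_nonneg.2 (fStar_le hb w₁)
  have hα0 : 0 ≤ α := by
    rw [hα, stepNonconvex]
    refine le_min ?_ (le_min ?_ (le_min ?_ ?_)) <;> positivity
  have hαL : α * (n * L) ≤ 1 := by
    rw [← le_div_iff₀ (by positivity), hα, stepNonconvex]
    exact (min_le_right _ _).trans (min_le_left _ _)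
  have hαL2 : α * (26 * (n + A) * L2inf) ≤ 1 := by
    rw [← le_div_iff₀ (by positivity), hα, stepNonconvex]
    exact (min_le_right _ _).trans ((min_le_right _ _).trans (min_le_left _ _))
  have hαLinf : α * (260 * n * Linf) ≤ 1 := by
    rw [← le_div_iff₀ (by positivity), hα, stepNonconvex]
    exact (min_le_right _ _).trans ((min_le_right _ _).trans (min_le_right _ _))
  have hsum := sum_norm_gradient_sq_le hn hf hb hL hL2 hLinf hς hA hg hα0 hαL hαL2 hαLinf hbal
    w₁ σ₁
  rw [← hF] at hsum
  have hre : ∑ k ∈ Finset.Icc 1 K, ‖gradient (avgLoss f) (weight f α bal w₁ σ₁ k)‖ ^ 2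
      = ∑ k ∈ Finset.range K, ‖gradient (avgLoss f) (run f α bal w₁ σ₁ k).w‖ ^ 2 :=
    sum_Icc_one_sub_one (fun k => ‖gradient (avgLoss f) (run f α bal w₁ σ₁ k).w‖ ^ 2) K
  rw [hre]
  rcases hF0.eq_or_lt with hF0 | hF0
  -- If `F = 0` the step size vanishes and division by it is impossible; the suboptimality then
  -- stays zero, hence so do the gradients.
  · have hαz : α = 0 := by
      refine le_antisymm ?_ hα0
      rw [hα, stepNonconvex, ← hF0, zero_div, Real.zero_rpow (by norm_num)]
      exact min_le_left _ _
    have hz (k : ℕ) : ‖gradient (avgLoss f) (run f α bal w₁ σ₁ k).w‖ ^ 2 ≤ 0 := by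
      have h1 := hsum k
      have h2 := norm_gradient_sq_le hL hb hf (run f α bal w₁ σ₁ k).w
      have h3 : avgLoss f (run f α bal w₁ σ₁ k).w - fStar f ≤ 0 := by
        simpa [← hF0, hαz] using h1
      exact h2.trans (mul_nonpos_of_nonneg_of_nonpos (by positivity) h3)
    calc _ ≤ (1 / (K : ℝ)) * 0 := by
          gcongr
          exact Finset.sum_nonpos fun k _ => hz k
      _ ≤ _ := by
          rw [mul_zero, ← hF0]
          positivity
  · have hαpos : 0 < α := by
      rw [hα, stepNonconvex]
      refine lt_min ?_ (lt_min ?_ (lt_min ?_ ?_)) <;> positivity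
    have h1 := nonconvex_bound hn' hK' hA hς hL hL2 hLinf hF0 rfl hα
    have h2 := hsum K
    have h3 := sub_nonneg.2 (fStar_le hb (run f α bal w₁ σ₁ K).w)
    set G := ∑ k ∈ Finset.range K, ‖gradient (avgLoss f) (run f α bal w₁ σ₁ k).w‖ ^ 2
    have h4 : (1 / (K : ℝ)) * G ≤ 211 / 100 * (F / (α * n * K)) + ς ^ 2 / K
        + 613 / 100 * (L2inf * (α * A * ς)) ^ 2 := by
      have h5 : α * n * (49 / 100) * G ≤ 103 / 100 * F + α * n * (3 / 676) * ς ^ 2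
        + K * (3 * (α * n) * (L2inf * (α * A * ς)) ^ 2) := by linarith
      have hc : 0 < α * n * (49 / 100) * K := by positivity
      have h6 : α * n * (49 / 100) * K * ((1 / (K : ℝ)) * G) = α * n * (49 / 100) * G := by
        field_simp
      have h7 : α * n * (49 / 100) * K * (F / (α * n * K)) = 49 / 100 * F := by field_simp
      have h8 : α * n * (49 / 100) * K * (ς ^ 2 / K) = α * n * (49 / 100) * ς ^ 2 := by
        field_simp
      refine le_of_mul_le_mul_left ?_ hc
      rw [h6, mul_add, mul_add, mul_left_comm _ (211 / 100 : ℝ), h7, h8]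
      have p1 : 0 ≤ α * n * ς ^ 2 := by positivity
      have p2 : 0 ≤ K * (α * n * (L2inf * (α * A * ς)) ^ 2) := by positivity
      linarith
    linarith

/-- The step size is tuned so that `η * K = W`. The initial term decays like `exp (-W) * X`, which
the Lambert equation turns into `W`, so both terms are `T` times a polynomial in `W`. -/
theorem polyakLojasiewicz_bound {n A ς L2inf μ F α V X W T η : ℝ} {K : ℕ} (hn : 0 < n)
    (hK : 0 < K) (hA : 0 < A) (hς : 0 < ς) (hL2 : 0 < L2inf) (hμ : 0 < μ)
    (hV : V ≤ 2 * (F + ς ^ 2)) (hV0 : 0 ≤ V)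
    (hX : F + ς ^ 2 = 256 * T * X) (hT : T = A ^ 2 * L2inf ^ 2 * ς ^ 2 / (μ ^ 3 * n ^ 2 * K ^ 2))
    (hW0 : 0 ≤ W) (hWX : W * Real.exp W = X) (hα : α = 2 / (n * μ * K) * W)
    (hη : η = α * n * μ / 2) (hη1 : η ≤ 1 / 10) :
    (1 - η) ^ (K - 1) * V + 6 * (L2inf * (α * A * ς)) ^ 2 / μ
      ≤ 1560 * T * (1 + W) ^ 2 := by
  have hK' : (0 : ℝ) < K := by exact_mod_cast hK
  have hT0 : 0 < T := by rw [hT]; positivity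
  have h1 : 6 * (L2inf * (α * A * ς)) ^ 2 / μ = 24 * T * W ^ 2 := by
    rw [hα, hT]; field_simp; ring
  have hηK : η * K = W := by rw [hη, hα]; field_simp
  -- The weight `w_K` has seen only `K - 1` epochs; the missing one costs the factor `exp 1`.
  have h2 : (1 - η) ^ (K - 1) ≤ Real.exp 1 * Real.exp (-W) := by
    calc (1 - η) ^ (K - 1) ≤ Real.exp (-η) ^ (K - 1) := by
          gcongr
          · linarith
          · exact Real.one_sub_le_exp_neg η
      _ = Real.exp (η - W) := by
          rw [← Real.exp_nat_mul, Nat.cast_sub hK, ← hηK]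
          congr 1
          push_cast
          ring
      _ ≤ Real.exp (1 - W) := by gcongr; linarith
      _ = _ := by rw [← Real.exp_add, sub_eq_add_neg]
  have h3 : Real.exp (-W) * X = W := by
    rw [← hWX, mul_left_comm, ← Real.exp_add]; simp
  have h4 : (1 - η) ^ (K - 1) * V ≤ 1536 * T * W := by
    calc (1 - η) ^ (K - 1) * V ≤ Real.exp 1 * Real.exp (-W) * (2 * (F + ς ^ 2)) := by gcongr
      _ = Real.exp 1 * (512 * T * (Real.exp (-W) * X)) := by rw [hX]; ring
      _ ≤ 3 * (512 * T * (Real.exp (-W) * X)) := by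
          rw [h3]
          gcongr
          linarith [Real.exp_one_lt_d9]
      _ = _ := by rw [h3]; ring
  rw [h1]
  nlinarith [mul_nonneg hT0.le hW0, mul_nonneg hT0.le (sq_nonneg W)]

theorem exists_polyakLojasiewicz_rate {n : ℕ} {A ς L L2inf Linf μ F : ℝ} (hn : 0 < n)
    (hA : 0 < A) (hς : 0 < ς) (hL : 0 < L) (hL2 : 0 < L2inf) (hLinf : 0 < Linf) (hμ : 0 < μ) :
    ∃ K₀ : ℕ, ∀ K : ℕ, K₀ ≤ K → 0 < K →
      ∀ (d : ℕ) (f : Fin n → Vec d → ℝ) (bal : ℕ → SignRule d)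
        (w₁ : Vec d) (σ₁ : Equiv.Perm (Fin n)) (α : ℝ),
        BddBelow (Set.range (avgLoss f)) →
        Smooth f L L2inf Linf →
        BoundedGradientError f ς →
        PolyakLojasiewicz f μ →
        (∀ k, BalancingBound n A (bal k)) →
        F = avgLoss f w₁ - fStar f →
        α = stepPL n K A ς L L2inf Linf μ F →
        avgLoss f (weight f α bal w₁ σ₁ K) - fStar f
          ≤ 1560 * (A ^ 2 * L2inf ^ 2 * ς ^ 2 / (μ ^ 3 * (n : ℝ) ^ 2 * (K : ℝ) ^ 2))
            * (1 + Real.log (1 + lambertArg n K A ς L2inf μ F)) ^ 2 := by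
  have hn' : (0 : ℝ) < n := by exact_mod_cast hn
  rcases lt_or_ge F 0 with hFneg | hF0
  · refine ⟨0, fun K _ _ d f bal w₁ σ₁ α hb _ _ _ _ hF _ => ?_⟩
    have := fStar_le hb w₁
    linarith
  have hc : 0 ≤ (F + ς ^ 2) * n ^ 2 * μ ^ 3 / (256 * A ^ 2 * L2inf ^ 2 * ς ^ 2) := by positivity
  have htend : Filter.Tendsto
      (fun K : ℕ => 2 / (n * μ * K) * lambertW0 (lambertArg n K A ς L2inf μ F))
      Filter.atTop (nhds 0) := by
    have := (tendsto_lambertW0_div hc).const_mul (2 / (n * μ))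
    rw [mul_zero] at this
    refine this.congr fun K => ?_
    have harg : lambertArg n K A ς L2inf μ F = (F + ς ^ 2) * n ^ 2 * μ ^ 3
        / (256 * A ^ 2 * L2inf ^ 2 * ς ^ 2) * (K : ℝ) ^ 2 := by
      rw [lambertArg]; ring
    rw [harg, ← div_div]
    ring
  have hsmall {b : ℝ} (hb : 0 < b) := htend.eventually_le_const hb
  -- For large `K` the Lambert term is the minimum. The bound `1 / (5 * n * μ)` yields `η ≤ 1 / 10`,
  -- and `1 / n` lets the initial `ς ^ 2` term be absorbed into `2 * (F + ς ^ 2)`.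
  obtain ⟨K₀, hK₀⟩ := Filter.eventually_atTop.1 <|
    (hsmall (b := 1 / (n * μ)) (by positivity)).and <|
    (hsmall (b := 1 / (n * L)) (by positivity)).and <|
    (hsmall (b := 1 / (52 * (n + A) * L2inf)) (by positivity)).and <|
    (hsmall (b := 1 / (520 * n * Linf)) (by positivity)).and <|
    (hsmall (b := 1 / (5 * n * μ)) (by positivity)).and (hsmall (b := 1 / n) (by positivity))
  refine ⟨K₀, fun K hKK₀ hK d f bal w₁ σ₁ α hb hf hg hPL hbal hF hα => ?_⟩
  have hK' : (0 : ℝ) < K := by exact_mod_cast hK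
  obtain ⟨b1, b2, b3, b4, b5, b6⟩ := hK₀ K hKK₀
  have hX0 : 0 ≤ lambertArg n K A ς L2inf μ F := by rw [lambertArg]; positivity
  have hXF : F + ς ^ 2 = 256 * (A ^ 2 * L2inf ^ 2 * ς ^ 2 / (μ ^ 3 * (n : ℝ) ^ 2 * (K : ℝ) ^ 2))
      * lambertArg n K A ς L2inf μ F := by
    rw [lambertArg]; field_simp
  obtain ⟨hW0, hWX⟩ := lambertW0_spec hX0
  have hWlog := lambertW0_le_log hX0
  set X := lambertArg n K A ς L2inf μ F with hX
  have hαW : α = 2 / (n * μ * K) * lambertW0 X := by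
    rw [hα, stepPL, ← hX, min_eq_right b4, min_eq_right b3, min_eq_right b2, min_eq_right b1]
  rw [← hαW] at b1 b2 b3 b4 b5 b6
  have hα0 : 0 ≤ α := by rw [hαW]; positivity
  rw [le_div_iff₀ (by positivity)] at b2 b3 b4 b5 b6
  have hηle : α * n * μ / 2 ≤ 1 / 10 := by linarith
  have hrate := suboptimality_le_of_polyakLojasiewicz hn hf hb hL hL2 hLinf hς hA hg hα0 b2
    (by have : 0 ≤ α * ((n + A) * L2inf) := by positivity
        linarith)
    (by have : 0 ≤ α * (n * Linf) := by positivity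
        linarith) hμ hηle hPL hbal w₁ σ₁ (K - 1)
  rw [← hF] at hrate
  refine hrate.trans ((polyakLojasiewicz_bound hn' hK hA hς hL2 hμ ?_ (by positivity) hXF rfl hW0
    hWX hαW rfl hηle).trans ?_)
  · have : α * n * ς ^ 2 ≤ 1 * ς ^ 2 := by gcongr
    nlinarith [sq_nonneg ς]
  · gcongr

end GraB
theorem theorem3 :
    -- the non-convex case
    (∀ (n d K : ℕ) (A ς L L2inf Linf : ℝ),
      0 < n → 0 < K → 0 < A → 0 < ς → 0 < L → 0 < L2inf → 0 < Linf →
      ∀ (f : Fin n → GraB.Vec d → ℝ) (bal : ℕ → GraB.SignRule d)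
        (w₁ : GraB.Vec d) (σ₁ : Equiv.Perm (Fin n)) (F α : ℝ),
        BddBelow (Set.range (GraB.avgLoss f)) →
        GraB.Smooth f L L2inf Linf →
        GraB.BoundedGradientError f ς →
        (∀ k, GraB.BalancingBound n A (bal k)) →
        F = GraB.avgLoss f w₁ - GraB.fStar f →
        α = GraB.stepNonconvex n K A ς L L2inf Linf F →
        (1 / (K : ℝ)) * ∑ k ∈ Finset.Icc 1 K,
            ‖gradient (GraB.avgLoss f) (GraB.weight f α bal w₁ σ₁ k)‖ ^ 2
          ≤ 11 * (A ^ 2 * ς ^ 2 * L2inf ^ 2 * F ^ 2 / ((n : ℝ) ^ 2 * (K : ℝ) ^ 2)) ^ ((1 : ℝ) / 3)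
            + ς ^ 2 / K
            + 1040 * (F * (L + L2inf + Linf)) / K
            + 104 * F * A * L2inf / (n * K)) ∧
    -- the PL case: `C` is absolute, `K₀` depends on the listed numbers only
    (∃ C : ℝ, 0 < C ∧
      ∀ (n : ℕ) (A ς L L2inf Linf μ F : ℝ),
        0 < n → 0 < A → 0 < ς → 0 < L → 0 < L2inf → 0 < Linf → 0 < μ →
        ∃ K₀ : ℕ, ∀ K : ℕ, K₀ ≤ K → 0 < K →
          ∀ (d : ℕ) (f : Fin n → GraB.Vec d → ℝ) (bal : ℕ → GraB.SignRule d)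
            (w₁ : GraB.Vec d) (σ₁ : Equiv.Perm (Fin n)) (α : ℝ),
            BddBelow (Set.range (GraB.avgLoss f)) →
            GraB.Smooth f L L2inf Linf →
            GraB.BoundedGradientError f ς →
            GraB.PolyakLojasiewicz f μ →
            (∀ k, GraB.BalancingBound n A (bal k)) →
            F = GraB.avgLoss f w₁ - GraB.fStar f →
            α = GraB.stepPL n K A ς L L2inf Linf μ F →
            GraB.avgLoss f (GraB.weight f α bal w₁ σ₁ K) - GraB.fStar f
              ≤ C * (A ^ 2 * L2inf ^ 2 * ς ^ 2 / (μ ^ 3 * (n : ℝ) ^ 2 * (K : ℝ) ^ 2))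
                * (1 + Real.log (1 + GraB.lambertArg n K A ς L2inf μ F)) ^ 2) := by
  refine ⟨?_, 1560, by norm_num, ?_⟩
  · intro n d K A ς L L2inf Linf hn hK hA hς hL hL2 hLinf f bal w₁ σ₁ F α hb hf hg hbal hF hα
    exact GraB.nonconvex_rate hn hK hA hς hL hL2 hLinf w₁ σ₁ hb hf hg hbal hF hα
  · intro n A ς L L2inf Linf μ F hn hA hς hL hL2 hLinf hμ
    exact GraB.exists_polyakLojasiewicz_rate hn hA hς hL hL2 hLinf hμ
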